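/- Let $\mathbf{DOM}$ be the category of domains (continuous dcpo's) and Scott-continuous maps. For a dcpo $D$ let $\mathcal V D$ be the set of subprobability valuations on $D$, i.e. the Scott-continuous maps $\nu$ from the lattice of Scott-open subsets of $D$ to $[0,1]$ with $\nu(\emptyset)=0$ and $\nu(U)+\nu(V)=\nu(U\cup V)+\nu(U\cap V)$, ordered pointwise (the stochastic order). Let $\mathcal S D\subseteq\mathcal V D$ be the set of simple valuations $\sum_{i=1}^n r_i\delta_{x_i}$ with $n\ge 0$, $r_i>0$, $\sum_i r_i\le 1$. Let $\mathcal M D$ be the intersection of all sub-dcpo's of $\mathcal V D$ containing $\mathcal S D$. Let $\mathcal W D$, respectively $\mathcal P D$, be the intersection of all subsets of $\mathcal V D$ that contain $\mathcal S D$ and are well-filtered, respectively sober, in the topology induced by the weak topology of $\mathcal V D$ (the one generated by the sets $\{\nu : \nu(U)>r\}$ with $U$ Scott-open and $r\in[0,1]$); well-filtered and sober spaces are understood to be $T_0$. A Kegelspitze is a dcpo $K$ with a distinguished element $\bot$ and operations $+_r\colon K\times K\to K$, $r\in[0,1]$, such that $a+_1b=a$, $a+_rb=b+_{1-r}a$,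 $a+_ra=a$, and $(a+_pb)+_rc=a+_{pr}(b+_{\frac{r-pr}{1-pr}}c)$ for $p,r<1$, each $+_r$ is Scott-continuous, and $(r,a)\mapsto a+_r\bot\colon[0,1]\times K\to K$ is Scott-continuous. It is continuous if $K$ is a domain. A map $f$ between Kegelspitzen is linear if $f(\bot)=\bot$ and $f(a+_rb)=f(a)+_rf(b)$ for all $a,b,r$. Theorem. (1) For every domain $D$, $\mathcal M D=\mathcal W D=\mathcal P D=\mathcal V D$. (2) Let $\mathcal F$ be any one of $\mathcal M,\mathcal V,\mathcal W,\mathcal P$. Then $\mathcal F$ is a monad on $\mathbf{DOM}$: for every domain $D$ the set $\mathcal F D$ with the stochastic order is a domain; the unit is $x\mapsto\delta_x$, and the Kleisli extension of a Scott-continuous map $f\colon D\to\mathcal F E$ is $f^\dagger(\nu)(U)=\int_{x\in D}f(x)(U)\,d\nu$, where $\int g\,d\nu=\int_0^1\nu(g^{-1}((t,1]))\,dt$. The Eilenberg–Moore category $\mathbf{DOM}^{\mathcal F}$ of this monad is isomorphic to the category of continuous Kegelspitzen and Scott-continuous linear maps, by an isomorphism that commutes with the forgetful functors to $\mathbf{DOM}$.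 -/

import Mathlib

open CategoryTheory Topology TopologicalSpace unitInterval

universe u v w

/-! ### Dcpo's, domains and Scott-continuous maps -/

/-- Directed completeness: every nonempty directed subset has a supremum. -/
def IsDcpo (α : Type u) [PartialOrder α] : Prop :=
  ∀ d : Set α, d.Nonempty → DirectedOn (· ≤ ·) d → ∃ a, IsLUB d a

/-- The way-below relation. -/
def WayBelow {α : Type u} [PartialOrder α] (x y : α) : Prop :=
  ∀ d : Set α, d.Nonempty → DirectedOn (· ≤ ·) d → ∀ s, IsLUB d s → y ≤ s → ∃ a ∈ d, x ≤ a

/-- `B` is a basis: for each `x`, the elements of `B` way below `x` form a directed set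
with supremum `x`. -/
def IsDomainBasis {α : Type u} [PartialOrder α] (B : Set α) : Prop :=
  ∀ x : α, {b | b ∈ B ∧ WayBelow b x}.Nonempty ∧
    DirectedOn (· ≤ ·) {b | b ∈ B ∧ WayBelow b x} ∧ IsLUB {b | b ∈ B ∧ WayBelow b x} x

/-- Continuity of a partial order: existence of a basis. -/
def IsContinuousOrder (α : Type u) [PartialOrder α] : Prop :=
  ∃ B : Set α, IsDomainBasis B

/-- `A` is a sub-dcpo: it is closed under suprema of nonempty directed subsets. -/
def IsSubDcpo {α : Type u} [PartialOrder α] (A : Set α) : Prop :=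
  ∀ d ⊆ A, d.Nonempty → DirectedOn (· ≤ ·) d → ∀ s, IsLUB d s → s ∈ A

/-- Scott-continuous maps. -/
@[ext]
structure ScottMap (α : Type u) (β : Type v) [PartialOrder α] [PartialOrder β] where
  toFun : α → β
  scottContinuous : ScottContinuous toFun

namespace ScottMap

variable {α : Type u} {β : Type v} {γ : Type w} [PartialOrder α] [PartialOrder β] [PartialOrder γ]

instance : CoeFun (ScottMap α β) (fun _ => α → β) := ⟨toFun⟩

/-- The identity map. -/
def id (α : Type u) [PartialOrder α] : ScottMap α α := ⟨fun x => x, ScottContinuous.id⟩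

/-- Composition `g ∘ f`. -/
def comp (g : ScottMap β γ) (f : ScottMap α β) : ScottMap α γ :=
  ⟨fun x => g (f x), ScottContinuous.comp f.scottContinuous g.scottContinuous⟩

end ScottMap

/-- A domain is a continuous dcpo. These are the objects of the category `DOM`. -/
structure Dom : Type (u + 1) where
  carrier : Type u
  [order : PartialOrder carrier]
  isDcpo : IsDcpo carrier
  isContinuous : IsContinuousOrder carrier

instance : CoeSort Dom.{u} (Type u) := ⟨Dom.carrier⟩

instance (D : Dom.{u}) : PartialOrder D := D.order

/-- The category `DOM` of domains and Scott-continuous maps. -/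
instance : Category Dom.{u} where
  Hom D E := ScottMap D E
  id D := ScottMap.id D
  comp f g := ScottMap.comp g f
  id_comp _ := rfl
  comp_id _ := rfl
  assoc _ _ _ := rfl

/-- Application of a morphism of domains to an element. -/
def Dom.app {D E : Dom.{u}} (f : D ⟶ E) (x : D) : E := ScottMap.toFun f x

/-! ### Subprobability valuations -/

/-- Subprobability valuations on a topological space: strict, modular, Scott-continuous maps
from the lattice of open sets to `[0,1]`. -/
@[ext]
structure SubVal (X : Type u) [TopologicalSpace X] where
  toFun : Opens X → I
  scottContinuous : ScottContinuous toFun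
  strict : toFun ⊥ = 0
  modular : ∀ U V : Opens X, (toFun U : ℝ) + toFun V = toFun (U ⊔ V) + toFun (U ⊓ V)

namespace SubVal

variable {X : Type u} [TopologicalSpace X]

instance : CoeFun (SubVal X) (fun _ => Opens X → I) := ⟨toFun⟩

/-- The stochastic order. -/
instance : PartialOrder (SubVal X) :=
  PartialOrder.lift toFun (fun _ _ h => SubVal.ext h)

/-- The weak topology, generated by the sets `[U > r]`. -/
instance : TopologicalSpace (SubVal X) :=
  TopologicalSpace.generateFrom {S | ∃ (U : Opens X) (r : I), S = {ν : SubVal X | r < ν U}}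

open Classical in
/-- The Dirac valuation at `x`. -/
noncomputable def dirac (x : X) : SubVal X where
  toFun U := if x ∈ U then 1 else 0
  scottContinuous := by
    intro d _ _ a ha
    have hmem : x ∈ a ↔ ∃ U ∈ d, x ∈ U := by
      rw [← ha.sSup_eq]; simp
    constructor
    · rintro _ ⟨U, hU, rfl⟩
      have := ha.1 hU
      by_cases hx : x ∈ U
      · simp [hx, this hx]
      · simp [hx]
    · intro b hb
      by_cases hx : x ∈ a
      · obtain ⟨U, hU, hxU⟩ := hmem.1 hx
        have := hb ⟨U, hU, rfl⟩
        simpa [hx, hxU] using this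
      · simp only [hx, if_false]; exact bot_le
  strict := by simp
  modular U V := by
    by_cases h₁ : x ∈ U <;> by_cases h₂ : x ∈ V <;> simp [h₁, h₂]

/-- Simple valuations: finite sums `∑ rᵢ δ_{xᵢ}` with `rᵢ > 0` and `∑ rᵢ ≤ 1`
(the empty sum is the zero valuation). -/
def IsSimple (ν : SubVal X) : Prop :=
  ∃ (n : ℕ) (r : Fin n → ℝ) (x : Fin n → X), (∀ i, 0 < r i) ∧ ∑ i, r i ≤ 1 ∧
    ∀ U : Opens X, (ν U : ℝ) = ∑ i, r i * (dirac (x i) U : ℝ)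

/-- The integral `∫ g dν = ∫₀¹ ν(g⁻¹(t,1]) dt` (Choquet formula). For `g` continuous into `[0,1]`
with its Scott topology the sets `g⁻¹(t,1]` are open, so that taking the interior changes nothing.
The integrand is antitone and bounded in `t`, hence (Riemann) integrable. -/
noncomputable def integral (ν : SubVal X) (g : X → I) : ℝ :=
  ∫ t in (0 : ℝ)..1, (ν (Opens.interior {x | t < (g x : ℝ)}) : ℝ)

end SubVal

/-! ### The families `V`, `M`, `W`, `P` of valuations on a dcpo -/

/-- A family of sets of valuations `F D ⊆ V D`, where `V D` consists of the subprobability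
valuations on `D` with its Scott topology. -/
abbrev ValFamily : Type (u + 1) :=
  (D : Type u) → [PartialOrder D] → Set (SubVal (WithScott D))

/-- All valuations. -/
def familyV : ValFamily.{u} := fun _ => Set.univ

/-- `M D` is the intersection of all sub-dcpo's of `V D` that contain the simple valuations. -/
def familyM : ValFamily.{u} := fun D =>
  {ν | ∀ A : Set (SubVal (WithScott D)), IsSubDcpo A → (∀ s, s.IsSimple → s ∈ A) → ν ∈ A}

/-- For a class `K` of topological spaces, the intersection of all subspaces of `V D` (with the weak
topology) that belong to `K` and contain the simple valuations. -/
def familyOfClass (K : (X : Type u) → [TopologicalSpace X] → Prop) : ValFamily.{u} := fun D =>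
  {ν | ∀ A : Set (SubVal (WithScott D)), K A → (∀ s, s.IsSimple → s ∈ A) → ν ∈ A}

/-- `x ≤ y` in the specialization order, i.e. `x ∈ closure {y}`; `S` is saturated if it is an
upper set for this order. -/
def IsSaturatedSet {X : Type u} [TopologicalSpace X] (S : Set X) : Prop :=
  ∀ x ∈ S, ∀ y, x ∈ closure {y} → y ∈ S

/-- Well-filtered (`T₀`) spaces. -/
def IsWellFiltered (X : Type u) [TopologicalSpace X] : Prop :=
  T0Space X ∧ ∀ 𝒦 : Set (Set X), 𝒦.Nonempty → DirectedOn (· ⊇ ·) 𝒦 →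
    (∀ S ∈ 𝒦, IsCompact S ∧ IsSaturatedSet S) →
    ∀ U : Set X, IsOpen U → ⋂₀ 𝒦 ⊆ U → ∃ S ∈ 𝒦, S ⊆ U

/-- Sober (`T₀`) spaces. -/
def IsSober (X : Type u) [TopologicalSpace X] : Prop :=
  T0Space X ∧ QuasiSober X

/-- `W D`, obtained from the class of well-filtered spaces. -/
def familyW : ValFamily.{u} := familyOfClass IsWellFiltered

/-- `P D`, obtained from the class of sober spaces. -/
def familyP : ValFamily.{u} := familyOfClass IsSober

/-! ### The monad of valuations on `DOM` given by a family -/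

/-- Kleisli triples on a category. -/
structure KleisliTriple (C : Type u) [Category.{v} C] where
  obj : C → C
  unit : ∀ X, X ⟶ obj X
  ext : ∀ {X Y}, (X ⟶ obj Y) → (obj X ⟶ obj Y)
  ext_unit : ∀ X, ext (unit X) = 𝟙 (obj X)
  unit_ext : ∀ {X Y} (f : X ⟶ obj Y), unit X ≫ ext f = f
  ext_ext : ∀ {X Y Z} (f : X ⟶ obj Y) (g : Y ⟶ obj Z), ext f ≫ ext g = ext (f ≫ ext g)

/-- The monad of a Kleisli triple: the functor sends `h` to `(h ≫ η)†`, and the multiplication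
is `(𝟙 (T X))†`. -/
def KleisliTriple.monad {C : Type u} [Category.{v} C] (T : KleisliTriple C) : Monad C where
  obj := T.obj
  map {_ Y} h := T.ext (h ≫ T.unit Y)
  map_id X := by rw [Category.id_comp, T.ext_unit]
  map_comp f g := by rw [T.ext_ext, Category.assoc, Category.assoc, T.unit_ext]
  η :=
    { app := T.unit
      naturality := fun _ Y f => (T.unit_ext (f ≫ T.unit Y)).symm }
  μ :=
    { app := fun X => T.ext (𝟙 (T.obj X))
      naturality := fun X Y f => by
        change T.ext (T.ext (f ≫ T.unit Y) ≫ T.unit (T.obj Y)) ≫ T.ext (𝟙 (T.obj Y)) =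
          T.ext (𝟙 (T.obj X)) ≫ T.ext (f ≫ T.unit Y)
        rw [T.ext_ext, T.ext_ext, Category.assoc, T.unit_ext, Category.comp_id,
          Category.id_comp] }
  assoc X := by rw [T.ext_ext, T.ext_ext, Category.assoc, T.unit_ext, Category.comp_id]; simp
  left_unit X := T.unit_ext (𝟙 (T.obj X))
  right_unit X := by
    change T.ext (T.unit X ≫ T.unit (T.obj X)) ≫ T.ext (𝟙 (T.obj X)) = 𝟙 (T.obj X)
    rw [T.ext_ext, Category.assoc, T.unit_ext, Category.comp_id, T.ext_unit]

/-- The family `F`, with the stochastic order, takes domains to domains. -/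
structure PreservesDom (F : ValFamily.{u}) : Prop where
  isDcpo : ∀ D : Dom.{u}, IsDcpo (F D)
  isContinuous : ∀ D : Dom.{u}, IsContinuousOrder (F D)

/-- The domain `F D`. -/
def PreservesDom.obj {F : ValFamily.{u}} (h : PreservesDom F) (D : Dom.{u}) : Dom.{u} where
  carrier := F D
  isDcpo := h.isDcpo D
  isContinuous := h.isContinuous D

/-- An element of the domain `F D`, as a valuation on `D`. -/
def PreservesDom.val {F : ValFamily.{u}} (h : PreservesDom F) {D : Dom.{u}} (ν : h.obj D) :
    SubVal (WithScott D) :=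
  Subtype.val (p := fun ν => ν ∈ F D) ν

/-- The monad structure on `DOM` given by a family `F` of valuations: the object `F D` with the
stochastic order, the Dirac valuations as unit, and the extension `f†(ν)(U) = ∫ f(x)(U) dν`.
All data are determined by `F`, so that there is at most one such term; its existence says that `F`
is a monad on `DOM`. -/
structure ValMonad (F : ValFamily.{u}) where
  preservesDom : PreservesDom F
  unit : ∀ D : Dom.{u}, D ⟶ preservesDom.obj D
  val_unit : ∀ (D : Dom.{u}) (x : D),
    preservesDom.val (Dom.app (unit D) x) = SubVal.dirac (WithScott.toScott x)
  ext : ∀ {D E : Dom.{u}}, (D ⟶ preservesDom.obj E) → (preservesDom.obj D ⟶ preservesDom.obj E)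
  val_ext : ∀ {D E : Dom.{u}} (f : D ⟶ preservesDom.obj E) (ν : preservesDom.obj D)
    (U : Opens (WithScott E)), (preservesDom.val (Dom.app (ext f) ν) U : ℝ) =
      (preservesDom.val ν).integral
        (fun x => preservesDom.val (Dom.app f (WithScott.ofScott x)) U)
  ext_unit : ∀ D : Dom.{u}, ext (unit D) = 𝟙 (preservesDom.obj D)
  unit_ext : ∀ {D E : Dom.{u}} (f : D ⟶ preservesDom.obj E), unit D ≫ ext f = f
  ext_ext : ∀ {D E G : Dom.{u}} (f : D ⟶ preservesDom.obj E) (g : E ⟶ preservesDom.obj G),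
    ext f ≫ ext g = ext (f ≫ ext g)

/-- The Kleisli triple on `DOM`. -/
def ValMonad.kleisliTriple {F : ValFamily.{u}} (T : ValMonad F) : KleisliTriple Dom.{u} where
  obj := T.preservesDom.obj
  unit := T.unit
  ext := T.ext
  ext_unit := T.ext_unit
  unit_ext := T.unit_ext
  ext_ext := T.ext_ext

/-- The monad on `DOM`. -/
def ValMonad.monad {F : ValFamily.{u}} (T : ValMonad F) : Monad Dom.{u} :=
  T.kleisliTriple.monad

/-! ### Kegelspitzen -/

/-- Barycentric algebra structures on a set; `conv r a b` is `a +_r b`. -/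
structure BarycentricAlgebra (A : Type u) where
  conv : I → A → A → A
  conv_one : ∀ a b, conv 1 a b = a
  conv_symm : ∀ r a b, conv r a b = conv (σ r) b a
  conv_self : ∀ r a, conv r a a = a
  conv_assoc : ∀ (p r q : I) (a b c : A), p < 1 → r < 1 →
    (q : ℝ) = ((r : ℝ) - p * r) / (1 - p * r) →
    conv r (conv p a b) c = conv (p * r) a (conv q b c)

/-- Pointed barycentric algebra structures, with distinguished element `bot`. -/
structure PointedBarycentricAlgebra (A : Type u) extends BarycentricAlgebra A where
  bot : A

/-- Kegelspitze structures on a partial order. -/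
structure Kegelspitze (K : Type u) [PartialOrder K] extends PointedBarycentricAlgebra K where
  isDcpo : IsDcpo K
  conv_scottContinuous : ∀ r : I, ScottContinuous (fun x : K × K => conv r x.1 x.2)
  smul_scottContinuous : ScottContinuous (fun x : I × K => conv x.1 x.2 bot)

/-- Continuous Kegelspitzen: domains with a Kegelspitze structure. -/
structure ContKegelspitze : Type (u + 1) where
  dom : Dom.{u}
  kegelspitze : Kegelspitze dom

/-- Linear maps of pointed barycentric algebras. -/
def IsBaryLinear {A : Type u} {B : Type v} (α : PointedBarycentricAlgebra A)
    (β : PointedBarycentricAlgebra B) (f : A → B) : Prop :=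
  f α.bot = β.bot ∧ ∀ (r : I) (a b : A), f (α.conv r a b) = β.conv r (f a) (f b)

namespace ContKegelspitze

/-- Scott-continuous linear maps. -/
@[ext]
structure Hom (K L : ContKegelspitze.{u}) where
  map : K.dom ⟶ L.dom
  linear : IsBaryLinear K.kegelspitze.toPointedBarycentricAlgebra
    L.kegelspitze.toPointedBarycentricAlgebra (Dom.app map)

/-- The category of continuous Kegelspitzen and Scott-continuous linear maps. -/
instance : Category ContKegelspitze.{u} where
  Hom := Hom
  id K := ⟨𝟙 K.dom, rfl, fun _ _ _ => rfl⟩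
  comp f g := ⟨f.map ≫ g.map, by
    refine ⟨?_, fun r a b => ?_⟩
    · exact (congrArg (Dom.app g.map) f.linear.1).trans g.linear.1
    · exact (congrArg (Dom.app g.map) (f.linear.2 r a b)).trans (g.linear.2 r _ _)⟩

/-- The forgetful functor to `DOM`. -/
def forget : ContKegelspitze.{u} ⥤ Dom.{u} where
  obj K := K.dom
  map f := f.map

end ContKegelspitze

/-! ### The way-below relation -/

section WayBelow

variable {α : Type u} [PartialOrder α] {x y x' y' : α}

/-! Everything rests on approximating valuations on a domain from below by simple ones. Finite
weights `t` are strictly below `ν` if every nonempty `J` in their support has mass less than `ν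
(reach J)`. These are finitely many strict inequalities, so they persist to some member of any
directed family with supremum `ν`; hence `simpleVal t` is way below `ν`. The core is
`exists_strictlyBelow`: finitely many lower bounds `r i < ν (G i)` can be met at once by weights
strictly below `ν`. It places the increments of `ν` along a list of points (`telescope`), ordered so
that no prescribed open set loses more than a small amount. Consequently every valuation is a
directed supremum of simple ones way below it. This makes `V D` a domain and gives `M D = V D`.
Directed families also have limits in well-filtered and in sober subspaces, which gives `W D = P D =
V D`.

The second pillar is the universal property of `V D`: every Scott-continuous `f : D → K` into a
Kegelspitze extends uniquely along `x ↦ δ_x` to a Scott-continuous linear map. On a simple valuation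
the value must be a barycenter, which is computed in the cone over `K`. Monotonicity is a transport
argument: comparable simple valuations satisfy Hall's condition, so that weight can be moved upwards
from one to the other (`HallCondition.flow`). The value at `ν` is the supremum of the barycenters of
weights strictly below `ν`. It returns the barycenter at simple valuations because moving the points
down and shrinking the weights gives weights strictly below (`extend_simpleVal`). Uniqueness is
`eq_of_forall_dirac`.

The rest follows from uniqueness. The integral is Scott-continuous and linear in the valuation, so
it is the extension (`extend_apply`); the monad laws need checking at Dirac valuations only. For an
algebra `a`, the associativity law on two-point valuations says that `a` is linear for the
operations `a (δ_x +_r δ_y)`. Conversely, the extension of the identity of a continuous Kegelspitze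
is an algebra structure. These constructions are mutually inverse, again by uniqueness. -/

theorem WayBelow.le (h : WayBelow x y) : x ≤ y := by
  obtain ⟨a, rfl, ha⟩ := h {y} (Set.singleton_nonempty y) (directedOn_singleton y) y
    isLUB_singleton le_rfl
  exact ha

theorem WayBelow.mono (h : WayBelow x y) (hx : x' ≤ x) (hy : y ≤ y') : WayBelow x' y' := by
  intro d hn hd s hs hle
  obtain ⟨a, ha, hxa⟩ := h d hn hd s hs (hy.trans hle)
  exact ⟨a, ha, hx.trans hxa⟩

/-- The basis elements way below `y` are cofinal among all elements way below `y`, so the latter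
inherit directedness and supremum, and the basis can be forgotten. -/
theorem IsContinuousOrder.wayBelow (h : IsContinuousOrder α) (y : α) :
    {x | WayBelow x y}.Nonempty ∧ DirectedOn (· ≤ ·) {x | WayBelow x y} ∧
      IsLUB {x | WayBelow x y} y := by
  obtain ⟨B, hB⟩ := h
  obtain ⟨⟨b, hb⟩, hd, hl⟩ := hB y
  refine ⟨⟨b, hb.2⟩, ?_, fun x hx => WayBelow.le hx, fun z hz => hl.2 fun b hb => hz hb.2⟩
  intro x₁ h₁ x₂ h₂
  obtain ⟨b₁, hb₁, hx₁⟩ := h₁ _ ⟨b, hb⟩ hd y hl le_rfl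
  obtain ⟨b₂, hb₂, hx₂⟩ := h₂ _ ⟨b, hb⟩ hd y hl le_rfl
  obtain ⟨c, hc, h1, h2⟩ := hd _ hb₁ _ hb₂
  exact ⟨c, hc.2, hx₁.trans h1, hx₂.trans h2⟩

/-- The interpolation property. -/
theorem IsContinuousOrder.interpolate (h : IsContinuousOrder α) (hxy : WayBelow x y) :
    ∃ z, WayBelow x z ∧ WayBelow z y := by
  -- The elements two way-below steps under `y` form a directed set with supremum `y`; hence `x`
  -- lies below one of them.
  have hne : {a | ∃ z, WayBelow a z ∧ WayBelow z y}.Nonempty := by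
    obtain ⟨z, hz⟩ := (h.wayBelow y).1
    obtain ⟨a, ha⟩ := (h.wayBelow z).1
    exact ⟨a, z, ha, hz⟩
  have hdir : DirectedOn (· ≤ ·) {a | ∃ z, WayBelow a z ∧ WayBelow z y} := by
    rintro a₁ ⟨z₁, ha₁, hz₁⟩ a₂ ⟨z₂, ha₂, hz₂⟩
    obtain ⟨z, hz, h1, h2⟩ := (h.wayBelow y).2.1 _ hz₁ _ hz₂
    obtain ⟨a, ha, h3, h4⟩ := (h.wayBelow z).2.1 _ (ha₁.mono le_rfl h1) _ (ha₂.mono le_rfl h2)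
    exact ⟨a, ⟨z, ha, hz⟩, h3, h4⟩
  have hlub : IsLUB {a | ∃ z, WayBelow a z ∧ WayBelow z y} y := by
    refine ⟨fun a ⟨z, ha, hz⟩ => ha.le.trans hz.le, fun b hb => ?_⟩
    refine (h.wayBelow y).2.2.2 fun z hz => ?_
    exact (h.wayBelow z).2.2.2 fun a ha => hb ⟨z, ha, hz⟩
  obtain ⟨a, ⟨z, ha, hz⟩, hxa⟩ := hxy _ hne hdir y hlub le_rfl
  exact ⟨z, ha.mono hxa le_rfl, hz⟩

/-- A poset in which every element is the supremum of a directed set of elements way below it is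
continuous. -/
theorem isContinuousOrder_of_forall
    (h : ∀ y : α, ∃ d : Set α, d.Nonempty ∧ DirectedOn (· ≤ ·) d ∧ IsLUB d y ∧
      ∀ x ∈ d, WayBelow x y) : IsContinuousOrder α := by
  refine ⟨Set.univ, fun y => ?_⟩
  obtain ⟨d, hn, hd, hl, hw⟩ := h y
  refine ⟨hn.mono fun x hx => ⟨trivial, hw x hx⟩, ?_, fun x hx => hx.2.le,
    fun z hz => hl.2 fun x hx => hz ⟨trivial, hw x hx⟩⟩
  rintro x₁ ⟨-, h₁⟩ x₂ ⟨-, h₂⟩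
  obtain ⟨b₁, hb₁, hx₁⟩ := h₁ d hn hd y hl le_rfl
  obtain ⟨b₂, hb₂, hx₂⟩ := h₂ d hn hd y hl le_rfl
  obtain ⟨c, hc, h1, h2⟩ := hd _ hb₁ _ hb₂
  exact ⟨c, ⟨trivial, hw c hc⟩, hx₁.trans h1, hx₂.trans h2⟩

theorem IsDcpo.of_orderIso {β : Type v} [PartialOrder β] (e : α ≃o β) (h : IsDcpo α) :
    IsDcpo β := by
  intro d hn hd
  obtain ⟨a, ha⟩ := h (e.symm '' d) (hn.image _)
    (hd.mono_comp (g := e.symm) fun _ _ h => e.symm.monotone h)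
  exact ⟨e a, by simpa using e.symm.isLUB_image.1 ha⟩

theorem IsContinuousOrder.of_orderIso {β : Type v} [PartialOrder β] (e : α ≃o β)
    (h : IsContinuousOrder α) : IsContinuousOrder β := by
  refine isContinuousOrder_of_forall fun y => ?_
  obtain ⟨hn, hd, hl⟩ := h.wayBelow (e.symm y)
  refine ⟨e '' {x | WayBelow x (e.symm y)}, hn.image _,
    hd.mono_comp (g := e) fun _ _ h => e.monotone h, ?_, ?_⟩
  · exact e.isLUB_image.2 (by simpa using hl)
  · rintro _ ⟨x, hx, rfl⟩ d hdn hdd s hs hys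
    obtain ⟨_, ⟨a, ha, rfl⟩, hxa⟩ := hx (e.symm '' d) (hdn.image _)
      (hdd.mono_comp (g := e.symm) fun _ _ h => e.symm.monotone h) (e.symm s)
      (e.symm.isLUB_image.2 (by simpa using hs)) (e.symm.monotone hys)
    exact ⟨a, ha, by simpa using e.monotone hxa⟩

end WayBelow

/-! ### Scott-open sets -/

section ScottOpen

variable {α : Type u} [PartialOrder α]

theorem isOpen_withScott_iff {U : Set (WithScott α)} :
    IsOpen U ↔ (∀ x y : α, x ≤ y → WithScott.toScott x ∈ U → WithScott.toScott y ∈ U) ∧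
      ∀ d : Set α, d.Nonempty → DirectedOn (· ≤ ·) d → ∀ a, IsLUB d a →
        WithScott.toScott a ∈ U → ∃ b ∈ d, WithScott.toScott b ∈ U := by
  rw [Topology.IsScott.isOpen_iff_isUpperSet_and_dirSupInaccOn (D := Set.univ)]
  constructor
  · rintro ⟨h1, h2⟩
    refine ⟨fun x y hxy hx => h1 hxy hx, fun d hn hd a ha hU => ?_⟩
    obtain ⟨b, hb, hb'⟩ := h2 (Set.mem_univ _) hn hd ha hU
    exact ⟨b, hb, hb'⟩
  · rintro ⟨h1, h2⟩
    refine ⟨fun x y hxy hx => h1 x y hxy hx, fun d _ hn hd a ha hU => ?_⟩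
    obtain ⟨b, hb, hb'⟩ := h2 d hn hd a ha hU
    exact ⟨b, hb, hb'⟩

theorem Opens.mem_of_le {U : Opens (WithScott α)} {x y : α} (hxy : x ≤ y)
    (hx : WithScott.toScott x ∈ U) : WithScott.toScott y ∈ U :=
  (isOpen_withScott_iff.1 U.isOpen).1 x y hxy hx

end ScottOpen

/-! ### Scott-open sets generated by points through the way-below relation. -/

section Reach

variable {D : Dom.{u}}

/-- The Scott-open set of all points that have an element of `S` way below them. -/
def reach (S : Set D) : Opens (WithScott D) where
  carrier := {y | ∃ x ∈ S, WayBelow x (WithScott.ofScott y)}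
  is_open' := by
    rw [isOpen_withScott_iff]
    refine ⟨?_, ?_⟩
    · rintro a b hab ⟨x, hx, hxa⟩
      exact ⟨x, hx, hxa.mono le_rfl hab⟩
    · rintro d hn hd a ha ⟨x, hx, hxa⟩
      -- Interpolation leaves room between `x` and `a`: some member of `d` is above `z`, and hence
      -- still has `x` way below it.
      obtain ⟨z, hxz, hza⟩ := D.isContinuous.interpolate hxa
      obtain ⟨b, hb, hzb⟩ := hza d hn hd a ha le_rfl
      exact ⟨b, hb, x, hx, hxz.mono le_rfl hzb⟩

theorem reach_mono {S T : Set D} (h : S ⊆ T) : reach S ≤ reach T :=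
  fun _ ⟨x, hx, hxy⟩ => ⟨x, h hx, hxy⟩

theorem reach_union (S T : Set D) : reach (S ∪ T) = reach S ⊔ reach T := by
  ext y
  simp only [reach, Opens.coe_mk, Opens.coe_sup, Set.mem_ofPred_eq, Set.mem_union]
  constructor
  · rintro ⟨x, hx | hx, h⟩
    exacts [Or.inl ⟨x, hx, h⟩, Or.inr ⟨x, hx, h⟩]
  · rintro (⟨x, hx, h⟩ | ⟨x, hx, h⟩)
    exacts [⟨x, Or.inl hx, h⟩, ⟨x, Or.inr hx, h⟩]

@[simp] theorem reach_empty : reach (∅ : Set D) = ⊥ := by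
  ext y; simp [reach]

theorem reach_le {S : Set D} {U : Opens (WithScott D)}
    (h : ∀ x ∈ S, WithScott.toScott x ∈ U) : reach S ≤ U :=
  fun _ ⟨x, hx, hxy⟩ => Opens.mem_of_le hxy.le (h x hx)

/-- The points of a Scott-open set, as a set of elements of the domain. -/
def Opens.points (U : Opens (WithScott D)) : Set D := {x | WithScott.toScott x ∈ U}

theorem Opens.exists_wayBelow {U : Opens (WithScott D)} {y : D} (hy : WithScott.toScott y ∈ U) :
    ∃ x, WithScott.toScott x ∈ U ∧ WayBelow x y := by
  obtain ⟨hn, hd, hl⟩ := D.isContinuous.wayBelow y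
  obtain ⟨b, hb, hbU⟩ := (isOpen_withScott_iff.1 U.isOpen).2 _ hn hd y hl hy
  exact ⟨b, hbU, hb⟩

/-- Every point of `U` has another point of `U` way below it. With finite sets the family is
directed, so that a valuation of `U` can be approximated through finitely many points. -/
theorem isLUB_reach (U : Opens (WithScott D)) :
    IsLUB ((fun s : Finset D => reach (s : Set D)) '' {s | (s : Set D) ⊆ Opens.points U}) U := by
  constructor
  · rintro _ ⟨s, hs, rfl⟩
    exact reach_le fun x hx => hs hx
  · intro V hV y hy
    obtain ⟨x, hx, hxy⟩ := Opens.exists_wayBelow (y := WithScott.ofScott y) hy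
    refine hV ⟨{x}, by simpa [Opens.points] using hx, rfl⟩ ?_
    exact ⟨x, by simp, hxy⟩

end Reach

/-! ### The cone over a barycentric algebra -/

section Cone

open scoped NNReal

/-- The cone over a barycentric algebra: formal multiples `r • a` with `r > 0`, and zero. -/
inductive Cone {A : Type u} (β : BarycentricAlgebra A) : Type u
  | zero : Cone β
  | pt (r : ℝ≥0) (hr : 0 < r) (a : A) : Cone β

/-- The fraction `r / (r + s)`, as an element of the unit interval. -/
noncomputable def frac (r s : ℝ≥0) : I :=
  ⟨(r / (r + s) : ℝ≥0), NNReal.coe_nonneg _, by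
    rw [← NNReal.coe_one, NNReal.coe_le_coe]
    exact div_le_one_of_le₀ le_self_add bot_le⟩

theorem coe_frac (r s : ℝ≥0) : (frac r s : ℝ) = r / (r + s) := by simp [frac]

theorem frac_symm {r s : ℝ≥0} (h : 0 < r + s) : σ (frac r s) = frac s r := by
  have h' : (0 : ℝ) < r + s := by exact_mod_cast h
  ext
  rw [coe_symm_eq, coe_frac, coe_frac, add_comm (s : ℝ)]
  field_simp
  ring

theorem frac_mul_mul {t : ℝ≥0} (ht : 0 < t) (r s : ℝ≥0) : frac (t * r) (t * s) = frac r s := by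
  have h' : (t : ℝ) ≠ 0 := by exact_mod_cast ht.ne'
  ext
  rw [coe_frac, coe_frac]
  push_cast
  rw [← mul_add, mul_div_mul_left _ _ h']

namespace Cone

variable {A : Type u} {β : BarycentricAlgebra A}

instance : Zero (Cone β) := ⟨zero⟩

noncomputable instance : Add (Cone β) where
  add
    | zero, v => v
    | u, zero => u
    | pt r hr a, pt s _ b =>
      pt (r + s) (add_pos_of_pos_of_nonneg hr bot_le) (β.conv (frac r s) a b)

noncomputable instance : AddCommMonoid (Cone β) where
  nsmul := nsmulRec
  zero_add u := rfl
  add_zero u := by cases u <;> rfl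
  add_comm u v := by
    cases u with
    | zero => cases v <;> rfl
    | pt r hr a => cases v with
      | zero => rfl
      | pt s hs b =>
        change pt (r + s) _ _ = pt (s + r) _ _
        congr 1
        · exact add_comm r s
        · rw [β.conv_symm, frac_symm (add_pos hr hs)]
  add_assoc u v w := by
    cases u with
    | zero => rfl
    | pt r hr a => cases v with
      | zero => rfl
      | pt s hs b => cases w with
        | zero => rfl
        | pt t ht c =>
          change pt (r + s + t) _ _ = pt (r + (s + t)) _ _
          have hr' : (0 : ℝ) < r := hr
          have hs' : (0 : ℝ) < s := hs
          have ht' : (0 : ℝ) < t := ht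
          congr 1
          · exact add_assoc r s t
          -- With `p = r / (r + s)` and `q = (r + s) / (r + s + t)` one has `p * q = r / (r + s +
          -- t)` and `(q - p * q) / (1 - p * q) = s / (s + t)`.
          · rw [β.conv_assoc (frac r s) (frac (r + s) t) (frac s t)]
            · congr 1
              ext
              rw [Set.Icc.coe_mul, coe_frac, coe_frac, coe_frac]
              push_cast
              field_simp
              ring
            · rw [← Subtype.coe_lt_coe, coe_frac]
              change _ < (1 : ℝ)
              rw [div_lt_one (by positivity)]
              linarith
            · rw [← Subtype.coe_lt_coe, coe_frac]
              change _ < (1 : ℝ)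
              push_cast
              rw [div_lt_one (by positivity)]
              linarith
            · rw [coe_frac, coe_frac, coe_frac]
              push_cast
              have h1 : (r : ℝ) / (r + s) * ((r + s) / (r + s + t)) = r / (r + s + t) := by
                field_simp
              have h2 : (1 : ℝ) - r / (r + s + t) = (s + t) / (r + s + t) := by
                field_simp
                ring
              rw [h1, h2]
              field_simp
              ring

theorem pt_add_pt (r s : ℝ≥0) (hr : 0 < r) (hs : 0 < s) (a b : A) :
    (pt r hr a + pt s hs b : Cone β) =
      pt (r + s) (add_pos_of_pos_of_nonneg hr bot_le) (β.conv (frac r s) a b) := rfl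

noncomputable instance : SMul ℝ≥0 (Cone β) where
  smul t u := match u with
    | zero => zero
    | pt r hr a => if h : 0 < t then pt (t * r) (mul_pos h hr) a else zero

theorem smul_pt {t : ℝ≥0} (ht : 0 < t) (r : ℝ≥0) (hr : 0 < r) (a : A) :
    (t • pt r hr a : Cone β) = pt (t * r) (mul_pos ht hr) a := dif_pos ht

theorem smul_zero' (t : ℝ≥0) : (t • (0 : Cone β)) = 0 := rfl

theorem zero_smul' (u : Cone β) : (0 : ℝ≥0) • u = 0 := by
  cases u with
  | zero => rfl
  | pt r hr a => exact dif_neg (lt_irrefl _)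

/-- With the module structure, identities between iterated binary convex combinations become linear
algebra, read off at mass `1`. -/
noncomputable instance : Module ℝ≥0 (Cone β) where
  one_smul u := by
    cases u with
    | zero => rfl
    | pt r hr a =>
      rw [smul_pt one_pos]
      congr 1
      exact one_mul r
  mul_smul s t u := by
    cases u with
    | zero => rfl
    | pt r hr a =>
      rcases eq_zero_or_pos s with rfl | hs
      · rw [zero_mul, zero_smul', zero_smul']
      rcases eq_zero_or_pos t with rfl | ht
      · rw [mul_zero, zero_smul', smul_zero']
      rw [smul_pt ht, smul_pt hs, smul_pt (mul_pos hs ht)]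
      congr 1
      exact mul_assoc s t r
  smul_zero t := rfl
  smul_add t u v := by
    rcases eq_zero_or_pos t with rfl | ht
    · simp only [zero_smul', add_zero]
    cases u with
    | zero => exact (zero_add _).symm
    | pt r hr a => cases v with
      | zero => exact (add_zero _).symm
      | pt s hs b =>
        rw [pt_add_pt, smul_pt ht, smul_pt ht, smul_pt ht, pt_add_pt]
        congr 1
        · exact mul_add t r s
        · rw [frac_mul_mul ht]
  add_smul s t u := by
    rcases eq_zero_or_pos s with rfl | hs
    · rw [zero_add, zero_smul', zero_add]
    rcases eq_zero_or_pos t with rfl | ht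
    · rw [add_zero, zero_smul', add_zero]
    cases u with
    | zero => rfl
    | pt r hr a =>
      rw [smul_pt ht, smul_pt hs, smul_pt (add_pos hs ht), pt_add_pt, β.conv_self]
      congr 1
      exact add_mul s t r
  zero_smul := zero_smul'

/-- The embedding of the algebra into its cone. -/
def of (a : A) : Cone β := pt 1 one_pos a

theorem smul_of {t : ℝ≥0} (ht : 0 < t) (a : A) : (t • of a : Cone β) = pt t ht a := by
  rw [of, smul_pt ht]
  congr 1
  exact mul_one t

/-- The total mass of an element of the cone. -/
def mass : Cone β →ₗ[ℝ≥0] ℝ≥0 where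
  toFun
    | zero => 0
    | pt r _ _ => r
  map_add' u v := by
    cases u with
    | zero => exact (zero_add _).symm
    | pt r hr a => cases v with
      | zero => exact (add_zero _).symm
      | pt s hs b => rfl
  map_smul' t u := by
    cases u with
    | zero => exact (mul_zero _).symm
    | pt r hr a =>
      rcases eq_zero_or_pos t with rfl | ht
      · rw [zero_smul']; exact (zero_mul _).symm
      · rw [smul_pt ht]; rfl

@[simp] theorem mass_of (a : A) : mass (of a : Cone β) = 1 := rfl

/-- The underlying point of an element of the cone, with a given value at zero. -/
def val (o : A) : Cone β → A
  | zero => o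
  | pt _ _ a => a

@[simp] theorem val_of (o a : A) : val o (of a : Cone β) = a := rfl

theorem eq_of_mass_eq_one (o : A) {u : Cone β} (h : mass u = 1) : u = of (val o u) := by
  cases u with
  | zero => exact absurd h zero_ne_one
  | pt r hr a =>
    change r = 1 at h
    subst h
    rfl

theorem eq_smul_of (o : A) (u : Cone β) : u = mass u • of (val o u) := by
  cases u with
  | zero => exact (zero_smul' _).symm
  | pt r hr a => exact (smul_of hr a).symm

theorem smul_of_add_smul_of (r : I) (a b : A) :
    (toNNReal r • of a + toNNReal (σ r) • of b : Cone β) = of (β.conv r a b) := by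
  -- At the endpoints one summand is zero, and the addition of the cone does not involve `conv`.
  rcases eq_or_ne r 0 with rfl | h0
  · rw [β.conv_symm, symm_zero, β.conv_one]
    simp
  rcases eq_or_ne r 1 with rfl | h1
  · rw [symm_one, β.conv_one]
    simp
  have hr : 0 < toNNReal r := unitInterval.pos_iff_ne_zero.2 h0
  have hs : 0 < toNNReal (σ r) :=
    unitInterval.pos_iff_ne_zero.2 fun h => h1 (by rw [← symm_symm r, h, symm_zero])
  have hsum : toNNReal r + toNNReal (σ r) = 1 := by
    ext
    simp
  rw [smul_of hr, smul_of hs, pt_add_pt, of]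
  congr 1
  congr 1
  ext
  rw [coe_frac, ← NNReal.coe_add, hsum]
  simp

/-! ### Comparison of elements of equal mass. -/

section Order

variable [PartialOrder A]

/-- The order on the cone: it compares elements of equal mass. -/
def Le (u v : Cone β) : Prop := mass u = mass v ∧ ∀ o, val o u ≤ val o v

theorem Le.refl (u : Cone β) : Le u u := ⟨rfl, fun _ => le_rfl⟩

theorem Le.trans {u v w : Cone β} (h : Le u v) (h' : Le v w) : Le u w :=
  ⟨h.1.trans h'.1, fun o => (h.2 o).trans (h'.2 o)⟩

/-- Equal masses force corresponding summands to be both zero or both nonzero; in the nonzero case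
the coefficients agree and monotonicity of a single `conv r` suffices. -/
theorem Le.add (hβ : ∀ r, Monotone fun x : A × A => β.conv r x.1 x.2) {u v u' v' : Cone β}
    (h : Le u u') (h' : Le v v') : Le (u + v) (u' + v') := by
  refine ⟨by rw [map_add, map_add, h.1, h'.1], fun o => ?_⟩
  cases u with
  | zero => cases u' with
    | zero => exact h'.2 o
    | pt r hr a => exact absurd h.1.symm hr.ne'
  | pt r hr a => cases u' with
    | zero => exact absurd h.1 hr.ne'
    | pt r' hr' a' =>
      obtain rfl : r = r' := h.1
      cases v with
      | zero => cases v' with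
        | zero => exact h.2 o
        | pt s hs b => exact absurd h'.1.symm hs.ne'
      | pt s hs b => cases v' with
        | zero => exact absurd h'.1 hs.ne'
        | pt s' hs' b' =>
          obtain rfl : s = s' := h'.1
          exact hβ (frac r s) (show (a, b) ≤ (a', b') from ⟨h.2 o, h'.2 o⟩)

theorem Le.smul_of (c : ℝ≥0) {a b : A} (h : a ≤ b) : Le (c • of a : Cone β) (c • of b) := by
  rcases eq_zero_or_pos c with rfl | hc
  · rw [zero_smul, zero_smul]
    exact Le.refl _
  · rw [Cone.smul_of hc, Cone.smul_of hc]
    exact ⟨rfl, fun _ => h⟩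

end Order

end Cone

end Cone

/-! ### Finite weights and their barycenters -/

section Weights

open scoped NNReal

variable {X : Type v} {A : Type u}

/-- The mass that a finite family of weights gives to a set. -/
noncomputable def mass (J : Set X) : (X →₀ ℝ≥0) →ₗ[ℝ≥0] ℝ≥0 :=
  Finsupp.linearCombination ℝ≥0 (J.indicator 1)

open Classical in
theorem mass_single (J : Set X) (x : X) (c : ℝ≥0) :
    mass J (Finsupp.single x c) = if x ∈ J then c else 0 := by
  rw [mass, Finsupp.linearCombination_single, Set.indicator_apply]
  split_ifs <;> simp

open Classical in
theorem mass_eq_sum (J : Set X) (t : X →₀ ℝ≥0) :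
    mass J t = ∑ x ∈ t.support with x ∈ J, t x := by
  rw [mass, Finsupp.linearCombination_apply, Finsupp.sum, Finset.sum_filter]
  refine Finset.sum_congr rfl fun x _ => ?_
  rw [Set.indicator_apply]
  split_ifs <;> simp

theorem mass_mono {J K : Set X} (t : X →₀ ℝ≥0) (h : ∀ x ∈ J, t x ≠ 0 → x ∈ K) :
    mass J t ≤ mass K t := by
  classical
  rw [mass_eq_sum, mass_eq_sum]
  refine Finset.sum_le_sum_of_subset fun x hx => ?_
  simp only [Finset.mem_filter, Finsupp.mem_support_iff] at hx ⊢
  exact ⟨hx.1, h x hx.2 hx.1⟩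

theorem mass_congr {J K : Set X} (t : X →₀ ℝ≥0) (h : ∀ x, t x ≠ 0 → (x ∈ J ↔ x ∈ K)) :
    mass J t = mass K t :=
  le_antisymm (mass_mono t fun x hx hx0 => (h x hx0).1 hx)
    (mass_mono t fun x hx hx0 => (h x hx0).2 hx)

theorem mass_eq_zero {J : Set X} {t : X →₀ ℝ≥0} (h : ∀ x ∈ J, t x = 0) : mass J t = 0 := by
  classical
  rw [mass_eq_sum]
  exact Finset.sum_eq_zero fun x hx => h x (Finset.mem_filter.1 hx).2

@[simp] theorem mass_empty (t : X →₀ ℝ≥0) : mass (∅ : Set X) t = 0 := mass_eq_zero (by simp)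

theorem mass_union_add_inter (J K : Set X) (t : X →₀ ℝ≥0) :
    mass (J ∪ K) t + mass (J ∩ K) t = mass J t + mass K t := by
  rw [mass, mass, mass, mass]
  simp only [Finsupp.linearCombination_apply, Finsupp.sum, ← Finset.sum_add_distrib, ← smul_add]
  refine Finset.sum_congr rfl fun x _ => congrArg _ ?_
  classical
  by_cases h1 : x ∈ J <;> by_cases h2 : x ∈ K <;> simp [h1, h2]

theorem mass_mapDomain {Y : Type w} (φ : X → Y) (J : Set Y) (t : X →₀ ℝ≥0) :
    mass J (t.mapDomain φ) = mass (φ ⁻¹' J) t := by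
  rw [mass, Finsupp.linearCombination_mapDomain]
  rfl

theorem mass_filter (p : X → Prop) [DecidablePred p] (J : Set X) (t : X →₀ ℝ≥0) :
    mass J (t.filter p) = mass (J ∩ {x | p x}) t := by
  classical
  rw [mass_eq_sum, mass_eq_sum]
  refine Finset.sum_congr ?_ fun x hx => ?_
  · ext x
    simp [Finsupp.support_filter]
    tauto
  · simp at hx
    rw [Finsupp.filter_apply_pos]
    tauto

variable (κ : PointedBarycentricAlgebra A) (f : X → A)

/-- The element `∑ t x • f x + (1 - ∑ t x) • ⊥` of the cone. -/
noncomputable def conePoint (t : X →₀ ℝ≥0) : Cone κ.toBarycentricAlgebra :=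
  Finsupp.linearCombination ℝ≥0 (fun x => Cone.of (f x)) t +
    (1 - mass Set.univ t) • Cone.of κ.bot

/-- The barycenter `∑ t x • f x + (1 - ∑ t x) • ⊥`. -/
noncomputable def bary (t : X →₀ ℝ≥0) : A := (conePoint κ f t).val κ.bot

variable {κ f}

theorem mass_linearCombination (t : X →₀ ℝ≥0) :
    Cone.mass (Finsupp.linearCombination ℝ≥0
      (fun x => (Cone.of (f x) : Cone κ.toBarycentricAlgebra)) t) = mass Set.univ t := by
  rw [Finsupp.linearCombination_apply, Finsupp.sum, map_sum, mass_eq_sum]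
  simp

theorem mass_conePoint {t : X →₀ ℝ≥0} (ht : mass Set.univ t ≤ 1) :
    Cone.mass (conePoint κ f t) = 1 := by
  rw [conePoint, map_add, mass_linearCombination, map_smul, Cone.mass_of, smul_eq_mul, mul_one,
    add_tsub_cancel_of_le ht]

theorem conePoint_eq_of {t : X →₀ ℝ≥0} (ht : mass Set.univ t ≤ 1) :
    conePoint κ f t = Cone.of (bary κ f t) :=
  Cone.eq_of_mass_eq_one _ (mass_conePoint ht)

theorem bary_eq_of_conePoint {t : X →₀ ℝ≥0} {a : A} (h : conePoint κ f t = Cone.of a) :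
    bary κ f t = a := by
  rw [bary, h, Cone.val_of]

theorem bary_zero : bary κ f 0 = κ.bot := by
  apply bary_eq_of_conePoint
  simp [conePoint]

theorem bary_single (x : X) : bary κ f (Finsupp.single x 1) = f x := by
  apply bary_eq_of_conePoint
  simp [conePoint, mass_single]

theorem toNNReal_add_symm (r : I) : toNNReal r + toNNReal (σ r) = 1 := by
  ext
  simp

theorem mass_conv_le {t s : X →₀ ℝ≥0} (ht : mass Set.univ t ≤ 1) (hs : mass Set.univ s ≤ 1)
    (r : I) : mass Set.univ (toNNReal r • t + toNNReal (σ r) • s) ≤ 1 := by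
  rw [map_add, map_smul, map_smul, smul_eq_mul, smul_eq_mul, ← toNNReal_add_symm r]
  exact add_le_add (mul_le_of_le_one_right' ht) (mul_le_of_le_one_right' hs)

/-- On weights of mass at most `1` the truncated difference `1 - mass` is affine, so `conePoint`
commutes with convex combinations in the module. -/
theorem bary_conv {t s : X →₀ ℝ≥0} (ht : mass Set.univ t ≤ 1) (hs : mass Set.univ s ≤ 1)
    (r : I) : bary κ f (toNNReal r • t + toNNReal (σ r) • s) =
      κ.conv r (bary κ f t) (bary κ f s) := by
  apply bary_eq_of_conePoint
  rw [← Cone.smul_of_add_smul_of, ← conePoint_eq_of ht, ← conePoint_eq_of hs, conePoint, conePoint,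
    conePoint, smul_add, smul_add, smul_smul, smul_smul, add_add_add_comm, ← add_smul, map_add,
    map_smul, map_smul]
  congr 2
  rw [map_add, map_smul, map_smul, smul_eq_mul, smul_eq_mul]
  have h1 := tsub_add_cancel_of_le ht
  have h2 := tsub_add_cancel_of_le hs
  refine tsub_eq_of_eq_add ?_
  generalize 1 - mass Set.univ t = m at *
  generalize 1 - mass Set.univ s = n at *
  calc (1 : ℝ≥0) = toNNReal r * (m + mass Set.univ t) + toNNReal (σ r) * (n + mass Set.univ s) := by
        rw [h1, h2, mul_one, mul_one, toNNReal_add_symm]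
    _ = _ := by ring

/-- As a function of one of its points, a barycenter is a binary convex combination. -/
theorem exists_bary_add_single {u : X →₀ ℝ≥0} {c : ℝ≥0} (h : mass Set.univ u + c ≤ 1) :
    ∃ (r : I) (k : A), ∀ x, bary κ f (u + Finsupp.single x c) = κ.conv r (f x) k := by
  have hc : c ≤ 1 := le_add_self.trans h
  let r : I := ⟨c, c.2, by exact_mod_cast hc⟩
  -- The remaining part of the barycenter, of mass `1 - c`. If `c = 1` it is zero and its underlying
  -- point defaults to `κ.bot`, which then carries no weight.
  let w : Cone κ.toBarycentricAlgebra :=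
    Finsupp.linearCombination ℝ≥0 (fun x => Cone.of (f x)) u +
      (1 - (mass Set.univ u + c)) • Cone.of κ.bot
  have hw : Cone.mass w = toNNReal (σ r) := by
    simp only [w]
    rw [map_add, mass_linearCombination, map_smul, Cone.mass_of, smul_eq_mul, mul_one]
    have h1 : c = toNNReal r := rfl
    have h2 := toNNReal_add_symm r
    rw [← h1] at h2
    have h3 := tsub_add_cancel_of_le h
    have : mass Set.univ u + (1 - (mass Set.univ u + c)) + c = toNNReal (σ r) + c := by
      rw [add_comm (toNNReal (σ r)), h2]
      nth_rewrite 2 [← h3]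
      ring
    exact add_right_cancel this
  refine ⟨r, w.val κ.bot, fun x => bary_eq_of_conePoint ?_⟩
  rw [← Cone.smul_of_add_smul_of, ← hw, ← Cone.eq_smul_of, conePoint, map_add, map_add, mass_single]
  simp only [Finsupp.linearCombination_single, Set.mem_univ, if_true]
  have h1 : c = toNNReal r := rfl
  rw [← h1]
  simp only [w]
  abel

end Weights

/-! ### Transport of finite weights -/

section Transport

open scoped NNReal

variable {X : Type v} [PartialOrder X]

/-- `WeightFlow t s`: a part of the weights `s` is obtained from `t` by moving weight upwards. -/
inductive WeightFlow : (X →₀ ℝ≥0) → (X →₀ ℝ≥0) → Prop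
  | zero (s : X →₀ ℝ≥0) : WeightFlow 0 s
  | single {x y : X} (c : ℝ≥0) (h : x ≤ y) : WeightFlow (Finsupp.single x c) (Finsupp.single y c)
  | add {t s t' s' : X →₀ ℝ≥0} (h : WeightFlow t s) (h' : WeightFlow t' s') :
    WeightFlow (t + t') (s + s')

/-- The upper set generated by `A`. -/
def upSet (A : Set X) : Set X := {y | ∃ x ∈ A, x ≤ y}

theorem upSet_mono {A B : Set X} (h : A ⊆ B) : upSet A ⊆ upSet B :=
  fun _ ⟨x, hx, hxy⟩ => ⟨x, h hx, hxy⟩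

theorem upSet_union (A B : Set X) : upSet (A ∪ B) = upSet A ∪ upSet B := by
  ext y
  constructor
  · rintro ⟨x, hx | hx, h⟩
    exacts [Or.inl ⟨x, hx, h⟩, Or.inr ⟨x, hx, h⟩]
  · rintro (⟨x, hx, h⟩ | ⟨x, hx, h⟩)
    exacts [⟨x, Or.inl hx, h⟩, ⟨x, Or.inr hx, h⟩]

/-- Hall's condition for a transport from `t` to `s`. -/
def HallCondition (t s : X →₀ ℝ≥0) : Prop := ∀ A : Set X, mass A t ≤ mass (upSet A) s

/-- The mass of `t` sees only points of `T`. Thus finitely many constraints remain, and a minimal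
slack exists. -/
theorem hallCondition_of_finset {t s : X →₀ ℝ≥0} (T : Finset X) (hT : t.support ⊆ T)
    (h : ∀ A : Finset X, A ⊆ T → mass (A : Set X) t ≤ mass (upSet (A : Set X)) s) :
    HallCondition t s := by
  classical
  intro A
  have hA : ((T.filter (· ∈ A) : Finset X) : Set X) ⊆ A := by
    intro x hx
    simpa using (Finset.mem_filter.1 (Finset.mem_coe.1 hx)).2
  refine le_trans ?_ ((h _ (Finset.filter_subset (· ∈ A) T)).trans
    (mass_mono s fun x hx _ => upSet_mono hA hx))
  refine mass_mono t fun x hx hx0 => ?_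
  simpa using ⟨hT (Finsupp.mem_support_iff.2 hx0), hx⟩

theorem HallCondition.filter {t s : X →₀ ℝ≥0} (h : HallCondition t s) (A : Set X)
    [DecidablePred (· ∈ A)] [DecidablePred (· ∈ upSet A)] :
    HallCondition (t.filter (· ∈ A)) (s.filter (· ∈ upSet A)) := by
  intro B
  rw [mass_filter, mass_filter]
  refine (h _).trans (mass_mono s fun x hx _ => ?_)
  exact ⟨upSet_mono Set.inter_subset_left hx, upSet_mono Set.inter_subset_right hx⟩

/-- Hall's condition for `B ∪ A`, with the equality for `A` cancelled from both sides, is the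
condition for `B` outside `A`. -/
theorem HallCondition.filter_not {t s : X →₀ ℝ≥0} (h : HallCondition t s) (A : Set X)
    [DecidablePred (· ∉ A)] [DecidablePred (· ∉ upSet A)]
    (hA : mass A t = mass (upSet A) s) :
    HallCondition (t.filter (· ∉ A)) (s.filter (· ∉ upSet A)) := by
  intro B
  rw [mass_filter, mass_filter]
  have key : ∀ (u : X →₀ ℝ≥0) (K L : Set X),
      mass (L ∪ K) u = mass (L ∩ {x | x ∉ K}) u + mass K u := by
    intro u K L
    rw [← mass_union_add_inter]
    have h1 : L ∩ {x | x ∉ K} ∪ K = L ∪ K := by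
      ext x; by_cases hx : x ∈ K <;> simp [hx]
    have h2 : L ∩ {x | x ∉ K} ∩ K = ∅ := by
      ext x; by_cases hx : x ∈ K <;> simp [hx]
    rw [h1, h2, mass_empty, add_zero]
  have h1 := h (B ∪ A)
  rw [upSet_union, key, key, hA] at h1
  exact le_of_add_le_add_right h1

/-- The supply-demand theorem: Hall's condition suffices for a transport. -/
theorem HallCondition.flow {t s : X →₀ ℝ≥0} (h : HallCondition t s) : WeightFlow t s := by
  classical
  obtain ⟨n, hn⟩ : ∃ n, t.support.card + s.support.card = n := ⟨_, rfl⟩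
  induction n using Nat.strong_induction_on generalizing t s with
  | _ n ih =>
    rcases eq_or_ne t 0 with rfl | ht
    · exact WeightFlow.zero s
    obtain ⟨x, hx⟩ : ∃ x, t x ≠ 0 := by
      by_contra! hc
      exact ht (Finsupp.ext hc)
    obtain ⟨y, hxy, hy⟩ : ∃ y, x ≤ y ∧ s y ≠ 0 := by
      by_contra! hc
      have h1 := h {x}
      rw [mass_eq_zero (t := s)] at h1
      · rw [mass_eq_sum, Finset.sum_eq_single x] at h1
        · exact hx (le_antisymm h1 bot_le)
        · intro b hb hbx
          simp at hb
          exact absurd hb.2 hbx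
        · intro hx'
          simpa using hx'
      · rintro y ⟨_, rfl, hxy⟩
        exact hc y hxy
    -- The constraints whose slack shrinks when weight moves from `x` to `y`: the upper set contains
    -- `y`, so the right side drops, while `x` is absent on the left.
    let S : Finset (Finset X) :=
      t.support.powerset.filter fun A => x ∉ A ∧ y ∈ upSet (A : Set X)
    let V : Finset ℝ≥0 := insert (t x) (insert (s y)
      (S.image fun A : Finset X => mass (upSet (A : Set X)) s - mass (A : Set X) t))
    have hV : V.Nonempty := ⟨t x, by simp [V]⟩
    -- The largest amount that can be moved from `x` to `y` while Hall's condition survives.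
    obtain ⟨ε, hεV, hε⟩ : ∃ ε ∈ V, ∀ v ∈ V, ε ≤ v :=
      ⟨V.min' hV, V.min'_mem hV, fun v hv => V.min'_le v hv⟩
    have hεx : ε ≤ t x := hε _ (by simp [V])
    have hεy : ε ≤ s y := hε _ (by simp [V])
    have hεS : ∀ A ∈ S, ε ≤ mass (upSet (A : Set X)) s - mass (A : Set X) t := fun A hA =>
      hε _ (Finset.mem_insert_of_mem (Finset.mem_insert_of_mem (Finset.mem_image.2 ⟨A, hA, rfl⟩)))
    obtain ⟨t', ht'⟩ : ∃ t', t' = t - Finsupp.single x ε := ⟨_, rfl⟩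
    obtain ⟨s', hs'⟩ : ∃ s', s' = s - Finsupp.single y ε := ⟨_, rfl⟩
    have hsuppt : t'.support ⊆ t.support := ht' ▸ Finsupp.support_tsub
    have hsupps : s'.support ⊆ s.support := hs' ▸ Finsupp.support_tsub
    have ht'x : t' x = t x - ε := by simp [ht']
    have hs'y : s' y = s y - ε := by simp [hs']
    have htt : t' + Finsupp.single x ε = t := by
      rw [ht']
      exact tsub_add_cancel_of_le (Finsupp.single_le_iff.2 hεx)
    have hss : s' + Finsupp.single y ε = s := by
      rw [hs']
      exact tsub_add_cancel_of_le (Finsupp.single_le_iff.2 hεy)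
    have hmt : ∀ A : Set X, mass A t = mass A t' + if x ∈ A then ε else 0 := fun A => by
      rw [← htt, map_add, mass_single]
    have hms : ∀ A : Set X, mass A s = mass A s' + if y ∈ A then ε else 0 := fun A => by
      rw [← hss, map_add, mass_single]
    have hall : HallCondition t' s' := by
      refine hallCondition_of_finset t.support hsuppt fun A hA => ?_
      have h1 := h A
      by_cases hyA : y ∈ upSet (A : Set X)
      · by_cases hxA : x ∈ (A : Set X)
        · rw [hmt, hms, if_pos hyA, if_pos hxA] at h1
          exact le_of_add_le_add_right h1
        · have hAS : A ∈ S := by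
            simp only [S, Finset.mem_filter, Finset.mem_powerset]
            exact ⟨hA, hxA, hyA⟩
          have h2 := (le_tsub_iff_right h1).1 (hεS A hAS)
          rw [hmt, hms, if_pos hyA, if_neg hxA, add_zero, add_comm] at h2
          exact le_of_add_le_add_right h2
      · have hxA : x ∉ (A : Set X) := fun hxA => hyA ⟨x, hxA, hxy⟩
        rw [hmt, hms, if_neg hyA, if_neg hxA, add_zero, add_zero] at h1
        exact h1
    suffices hf : WeightFlow t' s' by
      rw [← htt, ← hss]
      exact hf.add (WeightFlow.single ε hxy)
    have hcs : s'.support.card ≤ s.support.card := Finset.card_le_card hsupps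
    have hct : t'.support.card ≤ t.support.card := Finset.card_le_card hsuppt
    -- Either `x` or `y` is exhausted and a support shrinks, or some constraint `A` becomes tight.
    simp only [V, Finset.mem_insert, Finset.mem_image] at hεV
    rcases hεV with rfl | rfl | ⟨A, hAS, hAε⟩
    · refine ih _ ?_ hall rfl
      have : t'.support.card < t.support.card := by
        refine Finset.card_lt_card ⟨hsuppt, fun hc => ?_⟩
        have := hc (Finsupp.mem_support_iff.2 hx)
        rw [Finsupp.mem_support_iff, ht'x, tsub_self] at this
        exact this rfl
      omega
    · refine ih _ ?_ hall rfl
      have : s'.support.card < s.support.card := by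
        refine Finset.card_lt_card ⟨hsupps, fun hc => ?_⟩
        have := hc (Finsupp.mem_support_iff.2 hy)
        rw [Finsupp.mem_support_iff, hs'y, tsub_self] at this
        exact this rfl
      omega
    · simp only [S, Finset.mem_filter, Finset.mem_powerset] at hAS
      obtain ⟨hA, hxA, hyA⟩ := hAS
      have htight : mass (A : Set X) t' = mass (upSet (A : Set X)) s' := by
        have h1 := h A
        have h2 : mass (upSet (A : Set X)) s = ε + mass (A : Set X) t := by
          rw [← hAε, tsub_add_cancel_of_le h1]
        rw [hmt, hms, if_pos hyA, if_neg (by simpa using hxA), add_zero, add_comm] at h2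
        exact (add_left_cancel h2).symm
      obtain ⟨z, hzA, hzy⟩ := hyA
      -- Tightness splits the problem into a transport from `A` to `upSet A` and one between the
      -- complements. The first loses `x` from the support, the second loses `z ∈ A`.
      rw [← Finsupp.filter_add_filter_not t' (· ∈ (A : Set X)),
        ← Finsupp.filter_add_filter_not s' (· ∈ upSet (A : Set X))]
      have hlt : ∀ (p q : X → Prop) [DecidablePred p] [DecidablePred q] (z : X),
          z ∈ t.support → ¬ p z →
          (t'.filter p).support.card + (s'.filter q).support.card < n := by
        intro p q _ _ z hz hpz
        have h1 : (t'.filter p).support.card < t.support.card := by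
          refine Finset.card_lt_card ⟨?_, fun hc => ?_⟩
          · rw [Finsupp.support_filter]
            exact (Finset.filter_subset _ _).trans hsuppt
          · have := hc hz
            rw [Finsupp.support_filter, Finset.mem_filter] at this
            exact hpz this.2
        have h2 : (s'.filter q).support.card ≤ s.support.card := by
          rw [Finsupp.support_filter]
          exact Finset.card_le_card ((Finset.filter_subset _ _).trans hsupps)
        omega
      refine WeightFlow.add (ih _ ?_ (hall.filter _) rfl) (ih _ ?_ (hall.filter_not _ htight) rfl)
      · exact hlt _ _ x (Finsupp.mem_support_iff.2 hx) (by simpa using hxA)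
      · exact hlt _ _ z (hA hzA) (not_not.2 hzA)

variable {K : Type u} [PartialOrder K] {κ : PointedBarycentricAlgebra K} {f : X → K}

/-- The order of the cone compares equal masses only, so the mass `c` of `s` that receives nothing
from `t` is matched with multiples of the least element. -/
theorem WeightFlow.le (hκ : ∀ r, Monotone fun x : K × K => κ.conv r x.1 x.2)
    (hbot : ∀ a, κ.bot ≤ a) (hf : Monotone f) {t s : X →₀ ℝ≥0} (h : WeightFlow t s) :
    ∃ c, mass Set.univ t + c = mass Set.univ s ∧
      Cone.Le (Finsupp.linearCombination ℝ≥0 (fun x => Cone.of (f x)) t + c • Cone.of κ.bot :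
        Cone κ.toBarycentricAlgebra)
        (Finsupp.linearCombination ℝ≥0 (fun x => Cone.of (f x)) s) := by
  induction h with
  | zero s =>
    refine ⟨mass Set.univ s, by simp, ?_⟩
    rw [map_zero, zero_add]
    induction s using Finsupp.induction_linear with
    | zero => simpa using Cone.Le.refl _
    | add s s' h h' =>
      rw [map_add, map_add, add_smul]
      exact h.add hκ h'
    | single x c =>
      rw [mass_single, if_pos (Set.mem_univ _), Finsupp.linearCombination_single]
      exact Cone.Le.smul_of c (hbot _)
  | single c h =>
    refine ⟨0, by simp [mass_single], ?_⟩
    rw [zero_smul, add_zero, Finsupp.linearCombination_single, Finsupp.linearCombination_single]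
    exact Cone.Le.smul_of c (hf h)
  | add _ _ h h' =>
    obtain ⟨c, hc, h⟩ := h
    obtain ⟨c', hc', h'⟩ := h'
    refine ⟨c + c', by rw [map_add, map_add, ← hc, ← hc', add_add_add_comm], ?_⟩
    rw [map_add, map_add, add_smul, add_add_add_comm]
    exact h.add hκ h'

/-- Barycenters are monotone for transports. -/
theorem WeightFlow.bary_le (hκ : ∀ r, Monotone fun x : K × K => κ.conv r x.1 x.2)
    (hbot : ∀ a, κ.bot ≤ a) (hf : Monotone f) {t s : X →₀ ℝ≥0} (h : WeightFlow t s)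
    (hs : mass Set.univ s ≤ 1) : bary κ f t ≤ bary κ f s := by
  obtain ⟨c, hc, hle⟩ := h.le hκ hbot hf
  refine (Cone.Le.trans ?_ (hle.add hκ
    (Cone.Le.refl ((1 - mass Set.univ s) • Cone.of κ.bot)))).2 _
  rw [conePoint, add_assoc, ← add_smul]
  have : 1 - mass Set.univ t = c + (1 - mass Set.univ s) := by
    rw [← hc] at hs ⊢
    refine tsub_eq_of_eq_add ?_
    rw [add_right_comm, add_comm c, add_tsub_cancel_of_le hs]
  rw [this]
  exact Cone.Le.refl _

end Transport

/-! ### Suprema in the unit interval and limits along directed sets -/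

section Directed

open Filter

theorem unitInterval.isLUB_coe {S : Set I} (hS : S.Nonempty) {a : I} :
    IsLUB ((↑) '' S : Set ℝ) (a : ℝ) ↔ IsLUB S a := by
  constructor
  · intro h
    exact ⟨fun x hx => h.1 ⟨x, hx, rfl⟩, fun b hb => h.2 (by rintro _ ⟨x, hx, rfl⟩; exact hb hx)⟩
  · intro h
    refine ⟨by rintro _ ⟨x, hx, rfl⟩; exact h.1 hx, fun b hb => ?_⟩
    obtain ⟨x, hx⟩ := hS
    have hb0 : 0 ≤ b := x.2.1.trans (hb ⟨x, hx, rfl⟩)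
    -- An upper bound in `ℝ` may exceed `1` and is truncated; nonemptiness of `S` made it
    -- nonnegative.
    have : a ≤ ⟨min b 1, le_min hb0 zero_le_one, min_le_right _ _⟩ :=
      h.2 fun y hy => le_min (hb ⟨y, hy, rfl⟩) y.2.2
    exact le_trans this (min_le_left _ _)

theorem unitInterval.exists_isLUB (S : Set I) : ∃ a, IsLUB S a := by
  rcases S.eq_empty_or_nonempty with rfl | hS
  · exact ⟨0, by simp, fun b _ => b.2.1⟩
  obtain ⟨x, hx⟩ := hS
  have hbdd : BddAbove ((↑) '' S : Set ℝ) := ⟨1, by rintro _ ⟨y, -, rfl⟩; exact y.2.2⟩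
  have h := isLUB_csSup (Set.Nonempty.image _ ⟨x, hx⟩) hbdd
  refine ⟨⟨sSup ((↑) '' S : Set ℝ), x.2.1.trans (h.1 ⟨x, hx, rfl⟩),
    h.2 (by rintro _ ⟨y, -, rfl⟩; exact y.2.2)⟩, ?_⟩
  exact (unitInterval.isLUB_coe ⟨x, hx⟩).1 h

variable {P : Type u} [Preorder P] {d : Set P}

theorem DirectedOn.neBot (hn : d.Nonempty) (hd : DirectedOn (· ≤ ·) d) :
    (atTop : Filter d).NeBot :=
  have := hn.to_subtype
  have := hd.isDirectedOrder
  inferInstance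

/-- Directed suprema become limits along the directed set, so that sums and products pass through
them by continuity of real arithmetic. -/
theorem tendsto_of_isLUB {φ : P → I} (hφ : Monotone φ) {a : I} (hn : d.Nonempty)
    (h : IsLUB (φ '' d) a) : Tendsto (fun i : d => (φ i : ℝ)) atTop (𝓝 (a : ℝ)) := by
  refine tendsto_atTop_isLUB (fun i j hij => hφ hij) ?_
  have : Set.range (fun i : d => (φ i : ℝ)) = (↑) '' (φ '' d) := by
    ext; simp
  rw [this]
  exact (unitInterval.isLUB_coe (hn.image _)).2 h

theorem isLUB_of_tendsto {φ : P → I} (hφ : Monotone φ) {a : I} (hn : d.Nonempty)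
    (hd : DirectedOn (· ≤ ·) d)
    (h : Tendsto (fun i : d => (φ i : ℝ)) atTop (𝓝 (a : ℝ))) : IsLUB (φ '' d) a := by
  have := hn.to_subtype
  have := hd.isDirectedOrder
  have h1 := isLUB_of_tendsto_atTop (f := fun i : d => (φ i : ℝ)) (fun i j hij => hφ hij) h
  have : Set.range (fun i : d => (φ i : ℝ)) = (↑) '' (φ '' d) := by
    ext; simp
  rw [this] at h1
  exact (unitInterval.isLUB_coe (hn.image _)).1 h1

end Directed

/-! ### Subprobability valuations -/

namespace SubVal

open Filter

variable {X : Type u} [TopologicalSpace X]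

theorem mono (ν : SubVal X) {U V : Opens X} (h : U ≤ V) : ν U ≤ ν V :=
  ν.scottContinuous.monotone h

theorem monotone_apply (U : Opens X) : Monotone fun ν : SubVal X => ν U := fun _ _ h => h U

/-- Directed suprema of valuations exist, and are computed pointwise. -/
theorem exists_dirSup {d : Set (SubVal X)} (hn : d.Nonempty) (hd : DirectedOn (· ≤ ·) d) :
    ∃ s : SubVal X, ∀ U, IsLUB ((fun ν : SubVal X => ν U) '' d) (s U) := by
  choose φ hφ using fun U : Opens X => unitInterval.exists_isLUB ((fun ν : SubVal X => ν U) '' d)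
  have := DirectedOn.neBot hn hd
  have ht := fun U => tendsto_of_isLUB (monotone_apply U) hn (hφ U)
  refine ⟨⟨φ, ?_, ?_, ?_⟩, hφ⟩
  · intro e hen hed W hW
    constructor
    · rintro _ ⟨U, hU, rfl⟩
      refine (hφ U).2 ?_
      rintro _ ⟨ν, hν, rfl⟩
      exact (ν.mono (hW.1 hU)).trans ((hφ W).1 ⟨ν, hν, rfl⟩)
    · intro b hb
      refine (hφ W).2 ?_
      rintro _ ⟨ν, hν, rfl⟩
      refine (ν.scottContinuous hen hed hW).2 ?_
      rintro _ ⟨U, hU, rfl⟩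
      exact ((hφ U).1 ⟨ν, hν, rfl⟩).trans (hb ⟨U, hU, rfl⟩)
  · refine le_antisymm ((hφ ⊥).2 ?_) unitInterval.nonneg'
    rintro _ ⟨ν, -, rfl⟩
    exact ν.strict.le
  · intro U V
    refine tendsto_nhds_unique ((ht U).add (ht V)) ?_
    exact ((ht _).add (ht _)).congr fun ν => (ν.1.modular U V).symm

theorem isLUB_of_forall {d : Set (SubVal X)} {s : SubVal X}
    (h : ∀ U, IsLUB ((fun ν : SubVal X => ν U) '' d) (s U)) : IsLUB d s :=
  ⟨fun _ hν U => (h U).1 ⟨_, hν, rfl⟩, fun b hb U => (h U).2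
    (by rintro _ ⟨ν, hν, rfl⟩; exact hb hν U)⟩

theorem isDcpo : IsDcpo (SubVal X) := fun _ hn hd =>
  let ⟨s, hs⟩ := exists_dirSup hn hd
  ⟨s, isLUB_of_forall hs⟩

theorem scottContinuous_apply (U : Opens X) : ScottContinuous fun ν : SubVal X => ν U := by
  intro d hn hd s hs
  obtain ⟨s', hs'⟩ := exists_dirSup hn hd
  rw [hs.unique (isLUB_of_forall hs')]
  exact hs' U

theorem tendsto_apply {d : Set (SubVal X)} (hn : d.Nonempty) (hd : DirectedOn (· ≤ ·) d)
    {s : SubVal X} (hs : IsLUB d s) (U : Opens X) :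
    Tendsto (fun ν : d => (ν.1 U : ℝ)) atTop (𝓝 (s U : ℝ)) :=
  tendsto_of_isLUB (monotone_apply U) hn (scottContinuous_apply U hn hd hs)

/-- Submodularity: increments decrease. -/
theorem sub_le_sub (ν : SubVal X) {A B : Opens X} (h : A ≤ B) (C : Opens X) :
    (ν (B ⊔ C) : ℝ) - ν B ≤ ν (A ⊔ C) - ν A := by
  have h1 := ν.modular A C
  have h2 := ν.modular B C
  have h3 : (ν (A ⊓ C) : ℝ) ≤ ν (B ⊓ C) := ν.mono (inf_le_inf_right C h)
  linarith

theorem coe_strict (ν : SubVal X) : (ν ⊥ : ℝ) = 0 := by rw [ν.strict]; rfl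

theorem coe_mono (ν : SubVal X) {U V : Opens X} (h : U ≤ V) : (ν U : ℝ) ≤ ν V := ν.mono h

end SubVal

/-! ### Simple valuations -/

section Simple

open scoped NNReal

/-- Finite weights of total mass at most `1`. -/
abbrev SubWeights (X : Type u) : Type u := {t : X →₀ ℝ≥0 // mass Set.univ t ≤ 1}

variable {D : Dom.{u}}

theorem mass_le_univ {X : Type u} (J : Set X) (t : X →₀ ℝ≥0) : mass J t ≤ mass Set.univ t :=
  mass_mono t fun _ _ _ => Set.mem_univ _

theorem exists_finset_mass_eq {X : Type u} (J : Set X) (t : X →₀ ℝ≥0) :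
    ∃ F : Finset X, F ⊆ t.support ∧ (F : Set X) ⊆ J ∧ mass J t = mass (F : Set X) t := by
  classical
  refine ⟨t.support.filter (· ∈ J), Finset.filter_subset _ _, ?_, ?_⟩
  · intro x hx
    simpa using (Finset.mem_filter.1 (Finset.mem_coe.1 hx)).2
  · exact mass_congr t fun x hx => by simp [hx]

/-- The simple valuation given by finite weights. -/
noncomputable def simpleVal (t : SubWeights D) : SubVal (WithScott D) where
  toFun U := ⟨mass (Opens.points U) t.1, NNReal.coe_nonneg _, by
    exact_mod_cast (mass_le_univ _ _).trans t.2⟩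
  scottContinuous := by
    intro e hen hed W hW
    constructor
    · rintro _ ⟨U, hU, rfl⟩
      exact_mod_cast mass_mono t.1 fun x hx _ => hW.1 hU hx
    · intro b hb
      obtain ⟨F, -, hFW, hF⟩ := exists_finset_mass_eq (Opens.points W) t.1
      have hmem : ∀ x ∈ F, ∃ U ∈ e, WithScott.toScott x ∈ U := by
        intro x hx
        have : WithScott.toScott x ∈ W := hFW hx
        rw [← hW.sSup_eq] at this
        simpa using this
      obtain ⟨U, hU, hFU⟩ : ∃ U ∈ e, (F : Set D) ⊆ Opens.points U := by
        clear hF hFW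
        classical
        induction F using Finset.induction_on with
        | empty =>
          obtain ⟨U, hU⟩ := hen
          exact ⟨U, hU, by simp⟩
        | insert x F _ ih =>
          obtain ⟨U, hU, hFU⟩ := ih fun y hy => hmem y (Finset.mem_insert_of_mem hy)
          obtain ⟨V, hV, hxV⟩ := hmem x (Finset.mem_insert_self _ _)
          obtain ⟨T, hT, h1, h2⟩ := hed U hU V hV
          refine ⟨T, hT, ?_⟩
          rw [Finset.coe_insert, Set.insert_subset_iff]
          exact ⟨h2 hxV, hFU.trans h1⟩
      refine le_trans ?_ (hb ⟨U, hU, rfl⟩)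
      change ((mass (Opens.points W) t.1 : ℝ≥0) : ℝ) ≤ (mass (Opens.points U) t.1 : ℝ≥0)
      rw [hF]
      exact_mod_cast mass_mono t.1 fun x hx _ => hFU hx
  strict := by
    ext
    change ((mass (Opens.points ⊥) t.1 : ℝ≥0) : ℝ) = 0
    rw [NNReal.coe_eq_zero]
    exact mass_eq_zero fun x hx => absurd hx (by simp [Opens.points])
  modular U V := by
    change ((mass (Opens.points U) t.1 : ℝ≥0) : ℝ) + (mass (Opens.points V) t.1 : ℝ≥0) =
      (mass (Opens.points U ∪ Opens.points V) t.1 : ℝ≥0) +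
        (mass (Opens.points U ∩ Opens.points V) t.1 : ℝ≥0)
    exact_mod_cast (mass_union_add_inter _ _ _).symm

theorem simpleVal_apply (t : SubWeights D) (U : Opens (WithScott D)) :
    (simpleVal t U : ℝ) = mass (Opens.points U) t.1 := rfl

theorem simpleVal_single (x : D) :
    simpleVal ⟨Finsupp.single x 1, by simp [mass_single]⟩ =
      SubVal.dirac (WithScott.toScott x) := by
  classical
  ext U
  rw [simpleVal_apply]
  by_cases hx : WithScott.toScott x ∈ U
  · simp [mass_single, SubVal.dirac, Opens.points, hx]
  · simp [mass_single, SubVal.dirac, Opens.points, hx]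

theorem isSimple_simpleVal (t : SubWeights D) : (simpleVal t).IsSimple := by
  classical
  let e := t.1.support.equivFin
  refine ⟨t.1.support.card, fun i => t.1 (e.symm i), fun i => WithScott.toScott (e.symm i).1,
    fun i => ?_, ?_, fun U => ?_⟩
  · exact_mod_cast pos_iff_ne_zero.2 (Finsupp.mem_support_iff.1 (e.symm i).2)
  · rw [Equiv.sum_comp e.symm (fun x => ((t.1 x : ℝ≥0) : ℝ)),
      Finset.sum_coe_sort t.1.support (fun x => ((t.1 x : ℝ≥0) : ℝ))]
    have := t.2
    rw [mass_eq_sum] at this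
    simp only [Set.mem_univ, Finset.filter_true] at this
    exact_mod_cast this
  · rw [Equiv.sum_comp e.symm
      (fun x => ((t.1 x : ℝ≥0) : ℝ) * (SubVal.dirac (WithScott.toScott x.1) U : ℝ)),
      Finset.sum_coe_sort t.1.support
        (fun x => ((t.1 x : ℝ≥0) : ℝ) * (SubVal.dirac (WithScott.toScott x) U : ℝ)),
      simpleVal_apply, mass_eq_sum, Finset.sum_filter]
    push_cast
    refine Finset.sum_congr rfl fun x _ => ?_
    by_cases hx : WithScott.toScott x ∈ U
    · simp [SubVal.dirac, Opens.points, hx]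
    · simp [SubVal.dirac, Opens.points, hx]

/-- Hall's condition holds for weights whose valuations are comparable. -/
theorem hallCondition_of_le {t s : SubWeights D} (h : simpleVal t ≤ simpleVal s) :
    HallCondition t.1 s.1 := by
  intro A
  -- The complement of the finitely many principal lower sets of support points of `s` outside
  -- `upSet A`. It contains `A`, and it meets the support of `s` only inside `upSet A`.
  let U : Opens (WithScott D) :=
    ⟨{z | ∀ y ∈ s.1.support, y ∉ upSet A → ¬ WithScott.ofScott z ≤ y}, by
      rw [isOpen_withScott_iff]
      refine ⟨fun x y hxy hx z hz hzA hyz => hx z hz hzA (hxy.trans hyz), ?_⟩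
      intro d hn hd a ha haU
      by_contra! hc
      have hc' : ∀ b ∈ d, ∃ y ∈ s.1.support, y ∉ upSet A ∧ b ≤ y := by
        intro b hb
        have := hc b hb
        simpa using this
      -- A directed set covered by finitely many lower sets lies in one of them.
      obtain ⟨y, hy, hyA, hdy⟩ : ∃ y ∈ s.1.support, y ∉ upSet A ∧ ∀ b ∈ d, b ≤ y := by
        by_contra! hno
        have : ∀ F : Finset D, F ⊆ s.1.support → ∃ b ∈ d, ∀ y ∈ F, y ∉ upSet A → ¬ b ≤ y := by
          classical
          intro F
          induction F using Finset.induction_on with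
          | empty =>
            intro _
            obtain ⟨b, hb⟩ := hn
            exact ⟨b, hb, by simp⟩
          | insert x F _ ih =>
            intro hF
            obtain ⟨b, hb, hbF⟩ := ih ((Finset.subset_insert _ _).trans hF)
            by_cases hxA : x ∈ upSet A
            · refine ⟨b, hb, fun y hy hyA => ?_⟩
              rcases Finset.mem_insert.1 hy with rfl | hy
              exacts [absurd hxA hyA, hbF y hy hyA]
            · obtain ⟨c, hc, hcx⟩ := hno x (hF (Finset.mem_insert_self _ _)) hxA
              obtain ⟨e, he, h1, h2⟩ := hd b hb c hc
              refine ⟨e, he, fun y hy hyA hey => ?_⟩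
              rcases Finset.mem_insert.1 hy with rfl | hy
              exacts [hcx (h2.trans hey), hbF y hy hyA (h1.trans hey)]
        obtain ⟨b, hb, hbs⟩ := this s.1.support subset_rfl
        obtain ⟨y, hy, hyA, hby⟩ := hc' b hb
        exact hbs y hy hyA hby
      exact haU y hy hyA (ha.2 fun b hb => hdy b hb)⟩
  have h1 : mass A t.1 ≤ mass (Opens.points U) t.1 :=
    mass_mono t.1 fun x hx _ y _ hyA hxy => hyA ⟨x, hx, hxy⟩
  have h2 : mass (Opens.points U) s.1 ≤ mass (upSet A) s.1 := by
    refine mass_mono s.1 fun y hy hy0 => ?_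
    by_contra hyA
    exact hy y (Finsupp.mem_support_iff.2 hy0) hyA le_rfl
  have h3 : mass (Opens.points U) t.1 ≤ mass (Opens.points U) s.1 := by
    have := h U
    rw [← Subtype.coe_le_coe, simpleVal_apply, simpleVal_apply] at this
    exact_mod_cast this
  exact h1.trans (h3.trans h2)

/-- The weights `t` lie strictly below the valuation `ν`, in the sense that every nonempty part
of `t` has smaller mass than the set of points above it. -/
def StrictlyBelow (t : SubWeights D) (ν : SubVal (WithScott D)) : Prop :=
  ∀ J : Finset D, J ⊆ t.1.support → J.Nonempty → (mass (J : Set D) t.1 : ℝ) < ν (reach J)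

theorem StrictlyBelow.simpleVal_le {t : SubWeights D} {ν : SubVal (WithScott D)}
    (h : StrictlyBelow t ν) : simpleVal t ≤ ν := by
  intro U
  rw [← Subtype.coe_le_coe, simpleVal_apply]
  obtain ⟨F, hFt, hFU, hF⟩ := exists_finset_mass_eq (Opens.points U) t.1
  rw [hF]
  rcases F.eq_empty_or_nonempty with rfl | hne
  · simpa using (ν U).2.1
  · exact (h F hFt hne).le.trans (ν.coe_mono (reach_le fun x hx => hFU hx))

theorem StrictlyBelow.mono {t : SubWeights D} {μ ν : SubVal (WithScott D)}
    (h : StrictlyBelow t μ) (hμ : μ ≤ ν) : StrictlyBelow t ν :=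
  fun J hJ hne => (h J hJ hne).trans_le (hμ _)

/-- Finitely many subsets `J` of the support are involved, and each strict inequality holds
eventually along `d`. -/
theorem StrictlyBelow.exists_mem {t : SubWeights D} {d : Set (SubVal (WithScott D))}
    (hn : d.Nonempty) (hd : DirectedOn (· ≤ ·) d) {s : SubVal (WithScott D)} (hs : IsLUB d s)
    (h : StrictlyBelow t s) : ∃ ν ∈ d, StrictlyBelow t ν := by
  have := DirectedOn.neBot hn hd
  have : ∀ᶠ ν : d in Filter.atTop, ∀ J ∈ t.1.support.powerset,
      J.Nonempty → (mass (J : Set D) t.1 : ℝ) < ν.1 (reach (J : Set D)) := by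
    rw [Filter.eventually_all_finset]
    intro J hJ
    by_cases hne : J.Nonempty
    · filter_upwards [(SubVal.tendsto_apply hn hd hs (reach (J : Set D))).eventually_const_lt
        (h J (Finset.mem_powerset.1 hJ) hne)] with ν hν _ using hν
    · exact Filter.Eventually.of_forall fun _ h => absurd h hne
  obtain ⟨ν, hν⟩ := this.exists
  exact ⟨ν.1, ν.2, fun J hJ hne => hν J (Finset.mem_powerset.2 hJ) hne⟩

theorem StrictlyBelow.wayBelow {t : SubWeights D} {ν : SubVal (WithScott D)}
    (h : StrictlyBelow t ν) : WayBelow (simpleVal t) ν := by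
  intro d hn hd s hs hνs
  obtain ⟨μ, hμ, hμt⟩ := (h.mono hνs).exists_mem hn hd hs
  exact ⟨μ, hμ, hμt.simpleVal_le⟩

end Simple

/-! ### Lists of open sets -/

section Compatible

variable {L : Type u} [DistribLattice L] [OrderBot L]

/-- The join of a list. -/
def listSup (l : List L) : L := l.foldr (· ⊔ ·) ⊥

@[simp] theorem listSup_nil : listSup ([] : List L) = ⊥ := rfl

@[simp] theorem listSup_cons (a : L) (l : List L) : listSup (a :: l) = a ⊔ listSup l := rfl

theorem listSup_append (l m : List L) : listSup (l ++ m) = listSup l ⊔ listSup m := by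
  induction l with
  | nil => simp
  | cons a l ih => simp [ih, sup_assoc]

theorem listSup_map_inf (l : List L) (b : L) : listSup (l.map (· ⊓ b)) = listSup l ⊓ b := by
  induction l with
  | nil => simp
  | cons a l ih => simp [ih, inf_sup_right]

theorem le_listSup {a : L} {l : List L} (h : a ∈ l) : a ≤ listSup l := by
  induction l with
  | nil => simp at h
  | cons b l ih =>
    rcases List.mem_cons.1 h with rfl | h
    exacts [le_sup_left, (ih h).trans le_sup_right]

/-- Each member of the list is contained in `g`, or meets `g` only within the members after it. -/
def Compatible (g : L) : List L → Prop
  | [] => True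
  | a :: l => (a ≤ g ∨ a ⊓ g ≤ listSup l) ∧ Compatible g l

theorem Compatible.append {g : L} {l m : List L} (hl : Compatible g l) (hm : Compatible g m) :
    Compatible g (l ++ m) := by
  induction l with
  | nil => exact hm
  | cons a l ih =>
    refine ⟨hl.1.imp_right fun h => h.trans ?_, ih hl.2⟩
    change listSup l ≤ listSup (l ++ m)
    rw [listSup_append]
    exact le_sup_left

theorem Compatible.map_inf {g : L} {l : List L} (hl : Compatible g l) (b : L) :
    Compatible g (l.map (· ⊓ b)) := by
  induction l with
  | nil => trivial
  | cons a l ih =>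
    refine ⟨hl.1.imp inf_le_left.trans fun h => ?_, ih hl.2⟩
    rw [listSup_map_inf, inf_right_comm]
    exact inf_le_inf_right b h

theorem compatible_map_inf_self (g : L) (l : List L) : Compatible g (l.map (· ⊓ g)) := by
  induction l with
  | nil => trivial
  | cons a l ih => exact ⟨Or.inl inf_le_right, ih⟩

theorem Compatible.append_of_inf_le {g : L} {l m : List L} (hm : Compatible g m)
    (h : ∀ a ∈ l, a ⊓ g ≤ listSup m) : Compatible g (l ++ m) := by
  induction l with
  | nil => exact hm
  | cons a l ih =>
    refine ⟨Or.inr ((h a List.mem_cons_self).trans ?_),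
      ih fun b hb => h b (List.mem_cons_of_mem a hb)⟩
    change listSup m ≤ listSup (l ++ m)
    rw [listSup_append]
    exact le_sup_right

/-- To accommodate a new `b`, the list is followed by its traces on `b`. The traces are contained in
`b`, and each old member meets `b` inside its own later trace. For the other elements, compatibility
passes to the traces and to concatenations. -/
theorem exists_compatible [OrderTop L] (gs : List L) :
    ∃ l : List L, listSup l = ⊤ ∧ ∀ g ∈ gs, Compatible g l := by
  induction gs with
  | nil => exact ⟨[⊤], by simp, by simp⟩
  | cons b gs ih =>
    obtain ⟨l, hl, hg⟩ := ih
    refine ⟨l ++ l.map (· ⊓ b), by simp [listSup_append, hl], fun g hgb => ?_⟩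
    rcases List.mem_cons.1 hgb with rfl | hgs
    · exact (compatible_map_inf_self g l).append_of_inf_le fun a ha =>
        le_listSup (List.mem_map.2 ⟨a, ha, rfl⟩)
    · exact (hg g hgs).append ((hg g hgs).map_inf b)

end Compatible

/-! ### Approximation of valuations by simple valuations -/

section Approximation

open scoped NNReal

variable {D : Dom.{u}} (ν : SubVal (WithScott D))

/-- The points above some member of a list. -/
def reachList (l : List D) : Opens (WithScott D) := reach {x | x ∈ l}

theorem reachList_cons (b : D) (l : List D) : reachList (b :: l) = reachList l ⊔ reach {b} := by
  rw [reachList, reachList, ← reach_union]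
  congr 1
  ext x
  simp

theorem reachList_append (l m : List D) : reachList (l ++ m) = reachList l ⊔ reachList m := by
  rw [reachList, reachList, reachList, ← reach_union]
  congr 1
  ext x
  simp

/-- Each point of the list receives the mass of the points above it that are not above a later
member of the list. -/
noncomputable def telescope : List D → D →₀ ℝ≥0
  | [] => 0
  | b :: l => telescope l +
      Finsupp.single b (Real.toNNReal (ν (reachList (b :: l)) - ν (reachList l)))

open Classical in
theorem mass_telescope_cons (J : Set D) (b : D) (l : List D) :
    (mass J (telescope ν (b :: l)) : ℝ) = mass J (telescope ν l) +
      if b ∈ J then (ν (reachList (b :: l)) : ℝ) - ν (reachList l) else 0 := by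
  have h : (ν (reachList l) : ℝ) ≤ ν (reachList (b :: l)) := by
    rw [reachList_cons]
    exact ν.coe_mono le_sup_left
  rw [telescope, map_add, mass_single]
  split_ifs
  · rw [NNReal.coe_add, Real.coe_toNNReal _ (sub_nonneg.2 h)]
  · simp

/-- By submodularity, the increment that `b` contributes over the whole list is at most its
increment over the members in `J`, and these smaller increments add up. -/
theorem mass_telescope_le (J : Set D) (l : List D) :
    (mass J (telescope ν l) : ℝ) ≤ ν (reach (J ∩ {x | x ∈ l})) := by
  classical
  induction l with
  | nil => simp [telescope, ν.coe_strict]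
  | cons b l ih =>
    rw [mass_telescope_cons]
    split_ifs with hb
    · have h1 : J ∩ {x | x ∈ b :: l} = (J ∩ {x | x ∈ l}) ∪ {b} := by
        ext x
        simp only [Set.mem_inter_iff, Set.mem_ofPred_eq, List.mem_cons, Set.mem_union,
          Set.mem_singleton_iff]
        constructor
        · tauto
        · rintro (h | rfl) <;> tauto
      have h2 : reach (J ∩ {x | x ∈ l}) ≤ reachList l := reach_mono Set.inter_subset_right
      have h3 := ν.sub_le_sub h2 (reach {b})
      rw [h1, reach_union, reachList_cons]
      linarith
    · rw [add_zero]
      refine ih.trans (ν.coe_mono (reach_mono ?_))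
      intro x hx
      exact ⟨hx.1, List.mem_cons_of_mem _ hx.2⟩

theorem mass_telescope_mono (J : Set D) (l m : List D) :
    (mass J (telescope ν l) : ℝ) ≤ mass J (telescope ν (m ++ l)) := by
  classical
  induction m with
  | nil => exact le_rfl
  | cons b m ih =>
    refine ih.trans ?_
    rw [List.cons_append, mass_telescope_cons, reachList_cons]
    have h := ν.coe_mono (le_sup_left : reachList (m ++ l) ≤ reachList (m ++ l) ⊔ reach {b})
    split_ifs
    · linarith
    · simp

/-- When all the new points lie in `J`, every new increment counts and the sum telescopes. -/
theorem mass_telescope_append {J : Set D} (l : List D) {m : List D} (hm : ∀ b ∈ m, b ∈ J) :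
    (mass J (telescope ν (m ++ l)) : ℝ) =
      mass J (telescope ν l) + ν (reachList (m ++ l)) - ν (reachList l) := by
  classical
  induction m with
  | nil => simp
  | cons b m ih =>
    rw [List.cons_append, mass_telescope_cons, ih fun c hc => hm c (List.mem_cons_of_mem b hc),
      if_pos (hm b List.mem_cons_self)]
    ring

theorem exists_list_reach (U : Opens (WithScott D)) {ε : ℝ} (hε : 0 < ε) :
    ∃ m : List D, (∀ b ∈ m, WithScott.toScott b ∈ U) ∧ (ν U : ℝ) - ε < ν (reachList m) := by
  classical
  have hn : ((fun s : Finset D => reach (s : Set D)) ''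
      {s | (s : Set D) ⊆ Opens.points U}).Nonempty := ⟨_, ∅, by simp, rfl⟩
  have hd : DirectedOn (· ≤ ·) ((fun s : Finset D => reach (s : Set D)) ''
      {s | (s : Set D) ⊆ Opens.points U}) := by
    rintro _ ⟨s, hs, rfl⟩ _ ⟨t, ht, rfl⟩
    refine ⟨_, ⟨s ∪ t, ?_, rfl⟩, reach_mono (by simp), reach_mono (by simp)⟩
    simpa using ⟨hs, ht⟩
  have h := (unitInterval.isLUB_coe (hn.image _)).2 (ν.scottContinuous hn hd (isLUB_reach U))
  obtain ⟨_, ⟨_, ⟨_, ⟨s, hs, rfl⟩, rfl⟩, rfl⟩, h1, -⟩ :=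
    h.exists_between (sub_lt_self (ν U : ℝ) hε)
  refine ⟨s.toList, fun b hb => hs (Finset.mem_coe.2 (Finset.mem_toList.1 hb)), ?_⟩
  have : reachList s.toList = reach (s : Set D) := by
    rw [reachList]
    congr 1
    ext x
    simp
  rw [this]
  exact h1

/-- Each open set of the list is replaced by finitely many of its points, which receive only the
mass not covered by the later sets. Compatibility ensures that the mass thus assigned to a whole
block either lies in `G` or is not needed for `G`. -/
theorem exists_telescope (l : List (Opens (WithScott D))) {ε : ℝ} (hε : 0 < ε) :
    ∃ m : List D, reachList m ≤ listSup l ∧ (ν (listSup l) : ℝ) - ε ≤ ν (reachList m) ∧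
      ∀ G, Compatible G l →
        (ν (listSup l ⊓ G) : ℝ) - ε ≤ mass (Opens.points G) (telescope ν m) := by
  induction l generalizing ε with
  | nil =>
    refine ⟨[], ?_, ?_, fun G _ => ?_⟩
    · simp [reachList]
    · simp only [listSup_nil, ν.coe_strict, reachList]
      linarith [(ν (reach {x | x ∈ ([] : List D)})).2.1]
    · simp only [listSup_nil, bot_inf_eq, ν.coe_strict, telescope, map_zero, NNReal.coe_zero]
      linarith
  | cons A l ih =>
    -- For a member contained in `G` the losses add up to `3ε/4`: one quarter in the mass of `G`
    -- already placed and two in the covered total.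
    obtain ⟨m, hm, hνm, hG⟩ := ih (ε := ε / 4) (by linarith)
    obtain ⟨k, hk, hνk⟩ := exists_list_reach ν A (ε := ε / 4) (by linarith)
    have hkA : reachList k ≤ A := reach_le hk
    rw [listSup_cons]
    have h1 : (ν (A ⊔ listSup l) : ℝ) - ε / 2 ≤ ν (reachList (k ++ m)) := by
      rw [reachList_append]
      have e1 := ν.sub_le_sub hm A
      have e2 := ν.sub_le_sub hkA (reachList m)
      rw [sup_comm (listSup l), sup_comm (reachList m)] at e1
      linarith
    refine ⟨k ++ m, ?_, ?_, ?_⟩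
    · rw [reachList_append]
      exact sup_le_sup hkA hm
    · linarith
    · rintro G ⟨hA, hGl⟩
      have h2 := hG G hGl
      -- If `A ≤ G`, modularity shows that `A` adds the same mass to `listSup l ⊓ G` as to `listSup
      -- l`. Otherwise it adds no points to `listSup l ⊓ G`.
      rcases hA with hA | hA
      · rw [mass_telescope_append ν (J := Opens.points G) m fun b hb => hA (hk b hb)]
        have e1 := ν.modular A (listSup l)
        have e2 := ν.modular A (listSup l ⊓ G)
        have e3 : A ⊓ (listSup l ⊓ G) = A ⊓ listSup l := by
          rw [← inf_assoc, inf_eq_left]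
          exact inf_le_left.trans hA
        have e4 : A ⊔ (listSup l ⊓ G) = (A ⊔ listSup l) ⊓ G := by
          rw [sup_inf_left, sup_eq_right.2 hA]
        rw [e3, e4] at e2
        have e5 := ν.coe_mono hm
        linarith
      · have e1 : (A ⊔ listSup l) ⊓ G = listSup l ⊓ G := by
          rw [inf_sup_right, sup_eq_right]
          exact le_inf hA inf_le_right
        rw [e1]
        have := mass_telescope_mono ν (Opens.points G) m k
        linarith

/-- Every valuation is approximated, on finitely many open sets simultaneously, by simple
valuations strictly below it. -/
theorem exists_strictlyBelow {ι : Type v} (S : Finset ι) (G : ι → Opens (WithScott D))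
    (r : ι → ℝ) (h : ∀ i ∈ S, r i < ν (G i)) :
    ∃ t : SubWeights D, StrictlyBelow t ν ∧ ∀ i ∈ S, r i < mass (Opens.points (G i)) t.1 := by
  -- One `ε` pays for the telescope, the other for the scaling by `1 - ε`.
  obtain ⟨ε, hε, hε1, hεS⟩ : ∃ ε : ℝ, 0 < ε ∧ ε < 1 ∧ ∀ i ∈ S, r i + 2 * ε < ν (G i) := by
    have h1 : ∀ᶠ ε : ℝ in 𝓝[>] 0, ∀ i ∈ S, r i + 2 * ε < ν (G i) := by
      rw [Filter.eventually_all_finset]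
      intro i hi
      have : Filter.Tendsto (fun ε : ℝ => r i + 2 * ε) (𝓝[>] 0) (𝓝 (r i)) := by
        have : ContinuousAt (fun ε : ℝ => r i + 2 * ε) 0 := by fun_prop
        simpa using this.tendsto.mono_left nhdsWithin_le_nhds
      exact this.eventually_lt_const (h i hi)
    have h2 : ∀ᶠ ε : ℝ in 𝓝[>] 0, ε ∈ Set.Ioo (0 : ℝ) 1 := Ioo_mem_nhdsGT one_pos
    obtain ⟨ε, he, hε⟩ := (h1.and h2).exists
    exact ⟨ε, hε.1, hε.2, he⟩
  obtain ⟨l, hl, hcomp⟩ := exists_compatible (S.toList.map G)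
  obtain ⟨m, -, -, hm⟩ := exists_telescope ν l hε
  have hJ : ∀ J : Set D, (mass J (telescope ν m) : ℝ) ≤ ν (reach J) := fun J =>
    (mass_telescope_le ν J m).trans (ν.coe_mono (reach_mono Set.inter_subset_left))
  have hle : ∀ J : Set D, (mass J (telescope ν m) : ℝ) ≤ 1 := fun J => (hJ J).trans (ν _).2.2
  -- The scaling makes the bounds `hJ` strict on nonempty parts of the support, whose mass is
  -- positive.
  let c : ℝ≥0 := ⟨1 - ε, by linarith⟩
  have hc : (c : ℝ) = 1 - ε := rfl
  have hmass : ∀ J : Set D, (mass J (c • telescope ν m) : ℝ) =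
      (1 - ε) * mass J (telescope ν m) := fun J => by
    rw [map_smul, smul_eq_mul, NNReal.coe_mul, hc]
  refine ⟨⟨c • telescope ν m, ?_⟩, ?_, ?_⟩
  · rw [← NNReal.coe_le_coe, hmass, NNReal.coe_one]
    have := hle Set.univ
    have h0 : (0 : ℝ) ≤ mass Set.univ (telescope ν m) := NNReal.coe_nonneg _
    nlinarith
  · intro J hJs hne
    rw [hmass]
    refine lt_of_lt_of_le ?_ (hJ J)
    have h0 : (0 : ℝ) < mass (J : Set D) (telescope ν m) := by
      obtain ⟨x, hx⟩ := hne
      rw [NNReal.coe_pos, pos_iff_ne_zero]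
      intro h0
      classical
      have hx' : telescope ν m x ≠ 0 := by
        have := Finsupp.mem_support_iff.1 (hJs hx)
        rw [Finsupp.smul_apply, smul_eq_mul] at this
        exact right_ne_zero_of_mul this
      rw [mass_eq_sum, Finset.sum_eq_zero_iff] at h0
      exact hx' (h0 x (by simp [hx, hx']))
    nlinarith
  · intro i hi
    rw [hmass]
    have h1 := hm (G i) (hcomp _ (List.mem_map.2 ⟨i, by simpa using hi, rfl⟩))
    rw [hl, top_inf_eq] at h1
    have h2 := hεS i hi
    have h3 := hle (Opens.points (G i))
    nlinarith

/-- The simple valuations strictly below a valuation. -/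
def approximants : Set (SubVal (WithScott D)) := simpleVal '' {t | StrictlyBelow t ν}

theorem approximants_nonempty : (approximants ν).Nonempty := by
  obtain ⟨t, ht, -⟩ := exists_strictlyBelow ν (∅ : Finset ℕ) (fun _ => ⊥) (fun _ => 0) (by simp)
  exact ⟨_, t, ht, rfl⟩

theorem exists_strictlyBelow_ge {t₁ t₂ : SubWeights D} (h₁ : StrictlyBelow t₁ ν)
    (h₂ : StrictlyBelow t₂ ν) :
    ∃ t, StrictlyBelow t ν ∧ simpleVal t₁ ≤ simpleVal t ∧ simpleVal t₂ ≤ simpleVal t := by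
  classical
  -- The open sets to be approximated are the `reach J` for nonempty parts `J` of either support,
  -- with the mass of `J` as the bound to exceed.
  let P : SubWeights D → Finset (Finset D × SubWeights D) := fun t =>
    (t.1.support.powerset.filter Finset.Nonempty).image fun J => (J, t)
  obtain ⟨t, ht, htS⟩ := exists_strictlyBelow ν (P t₁ ∪ P t₂) (fun p => reach (p.1 : Set D))
    (fun p => mass (p.1 : Set D) p.2.1) (by
      intro p hp
      simp only [P, Finset.mem_union, Finset.mem_image, Finset.mem_filter,
        Finset.mem_powerset] at hp
      rcases hp with ⟨J, ⟨hJ, hne⟩, rfl⟩ | ⟨J, ⟨hJ, hne⟩, rfl⟩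
      exacts [h₁ J hJ hne, h₂ J hJ hne])
  have key : ∀ s, P s ⊆ P t₁ ∪ P t₂ → simpleVal s ≤ simpleVal t := by
    intro s hs U
    rw [← Subtype.coe_le_coe, simpleVal_apply, simpleVal_apply]
    obtain ⟨F, hFt, hFU, hF⟩ := exists_finset_mass_eq (Opens.points U) s.1
    rw [hF]
    rcases F.eq_empty_or_nonempty with rfl | hne
    · simp
    · have hFP : (F, s) ∈ P s := by
        simp only [P, Finset.mem_image, Finset.mem_filter, Finset.mem_powerset]
        exact ⟨F, ⟨hFt, hne⟩, rfl⟩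
      refine (htS _ (hs hFP)).le.trans ?_
      rw [NNReal.coe_le_coe]
      refine mass_mono t.1 fun x hx _ => ?_
      exact reach_le (fun y hy => hFU hy) hx
  exact ⟨t, ht, key t₁ Finset.subset_union_left, key t₂ Finset.subset_union_right⟩

theorem directedOn_approximants : DirectedOn (· ≤ ·) (approximants ν) := by
  rintro _ ⟨t₁, h₁, rfl⟩ _ ⟨t₂, h₂, rfl⟩
  obtain ⟨t, ht, h1, h2⟩ := exists_strictlyBelow_ge ν h₁ h₂
  exact ⟨_, ⟨t, ht, rfl⟩, h1, h2⟩

theorem exists_approximant {U : Opens (WithScott D)} {r : ℝ} (h : r < ν U) :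
    ∃ μ ∈ approximants ν, r < μ U := by
  obtain ⟨t, ht, htU⟩ := exists_strictlyBelow ν ({0} : Finset ℕ) (fun _ => U) (fun _ => r)
    (by simpa using h)
  exact ⟨_, ⟨t, ht, rfl⟩, htU 0 (by simp)⟩

theorem isLUB_approximants : IsLUB (approximants ν) ν := by
  refine ⟨by rintro _ ⟨t, ht, rfl⟩; exact ht.simpleVal_le, fun b hb U => ?_⟩
  by_contra! hlt
  obtain ⟨μ, hμ, hμU⟩ := exists_approximant ν (r := b U) hlt
  exact absurd (hb hμ U) (not_le.2 hμU)

theorem SubVal.isContinuousOrder : IsContinuousOrder (SubVal (WithScott D)) :=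
  isContinuousOrder_of_forall fun ν => ⟨approximants ν, approximants_nonempty ν,
    directedOn_approximants ν, isLUB_approximants ν, by
      rintro _ ⟨t, ht, rfl⟩; exact ht.wayBelow⟩

end Approximation

/-! ### The families of valuations agree on domains -/

section Families

variable (D : Dom.{u})

theorem familyM_eq : familyM D = familyV D := by
  refine Set.eq_univ_of_forall fun ν A hA hs => ?_
  refine hA (approximants ν) ?_ (approximants_nonempty ν) (directedOn_approximants ν) ν
    (isLUB_approximants ν)
  rintro _ ⟨t, -, rfl⟩
  exact hs _ (isSimple_simpleVal t)

/-- A set of valuations contains every valuation if it contains the simple ones and every directed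
subset of it converges to one of its upper bounds. -/
theorem mem_of_directed_limits {A : Set (SubVal (WithScott D))}
    (hA : ∀ s : SubVal (WithScott D), s.IsSimple → s ∈ A)
    (h : ∀ d : Set A, d.Nonempty → DirectedOn (fun x y => x ∈ closure {y}) d →
      ∃ z ∈ closure d, ∀ x ∈ d, x ∈ closure {z}) (ν : SubVal (WithScott D)) : ν ∈ A := by
  have hopen : ∀ (U : Opens (WithScott D)) (r : I), IsOpen {μ : SubVal (WithScott D) | r < μ U} :=
    fun U r => isOpen_generateFrom_of_mem ⟨U, r, rfl⟩
  have hup : ∀ {S : Set (SubVal (WithScott D))}, IsOpen S → ∀ μ ν, μ ≤ ν → μ ∈ S → ν ∈ S := by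
    intro S hS
    induction hS with
    | basic S hS =>
      obtain ⟨U, r, rfl⟩ := hS
      exact fun μ ν h hμ => lt_of_lt_of_le hμ (h U)
    | univ => exact fun _ _ _ _ => trivial
    | inter S T _ _ h1 h2 => exact fun μ ν h hμ => ⟨h1 μ ν h hμ.1, h2 μ ν h hμ.2⟩
    | sUnion 𝒮 _ ih =>
      rintro μ ν h ⟨S, hS, hμ⟩
      exact ⟨S, hS, ih S hS μ ν h hμ⟩
  -- The specialization order of the subspace is the stochastic order.
  have hle : ∀ x y : A, x ∈ closure {y} ↔ x.1 ≤ y.1 := by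
    intro x y
    rw [closure_subtype, Set.image_singleton, mem_closure_iff]
    constructor
    · intro hxy U
      by_contra! hlt
      obtain ⟨_, h1, rfl⟩ := hxy _ (hopen U (y.1 U)) hlt
      exact lt_irrefl (y.1 U) h1
    · exact fun hxy S hS hx => ⟨y.1, hup hS _ _ hxy hx, rfl⟩
  have hsub : approximants ν ⊆ A := by
    rintro _ ⟨t, -, rfl⟩
    exact hA _ (isSimple_simpleVal t)
  obtain ⟨z, hz, hzd⟩ := h (Subtype.val ⁻¹' approximants ν) (by
      obtain ⟨μ, hμ⟩ := approximants_nonempty ν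
      exact ⟨⟨μ, hsub hμ⟩, hμ⟩) (by
      rintro ⟨x, hxA⟩ hx ⟨y, hyA⟩ hy
      obtain ⟨w, hw, h1, h2⟩ := directedOn_approximants ν x hx y hy
      exact ⟨⟨w, hsub hw⟩, hw, (hle _ _).2 h1, (hle _ _).2 h2⟩)
  -- The limit `z` bounds the approximants, hence `ν`. It cannot exceed `ν` on an open set, since
  -- some approximant would then do so as well.
  have : ν = z.1 := by
    refine le_antisymm ((isLUB_approximants ν).2 fun μ hμ =>
      (hle ⟨μ, hsub hμ⟩ z).1 (hzd _ hμ)) fun U => ?_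
    by_contra! hlt
    rw [closure_subtype, mem_closure_iff] at hz
    obtain ⟨_, h1, μ, hμ, rfl⟩ := hz _ (hopen U (ν U)) hlt
    exact absurd ((isLUB_approximants ν).1 hμ U) (not_le.2 h1)
  rw [this]
  exact z.2

/-- The principal upper sets of members of `d` are compact, saturated and filtered. If no upper
bound of `d` were in `closure d`, one of these sets would avoid `closure d` by well-filteredness,
although its generator lies in `d`. -/
theorem familyW_eq : familyW D = familyV D := by
  refine Set.eq_univ_of_forall fun ν A hW hs => ?_
  refine mem_of_directed_limits D hs (fun d hn hd => ?_) ν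
  by_contra! hc
  have htrans : ∀ {x y z : A}, x ∈ closure {y} → y ∈ closure {z} → x ∈ closure {z} :=
    fun h1 h2 => closure_minimal (Set.singleton_subset_iff.2 h2) isClosed_closure h1
  obtain ⟨S, ⟨x, hx, rfl⟩, hS⟩ := hW.2 ((fun x => {y | x ∈ closure {y}}) '' d) (hn.image _) (by
      rintro _ ⟨x, hx, rfl⟩ _ ⟨y, hy, rfl⟩
      obtain ⟨z, hz, h1, h2⟩ := hd x hx y hy
      exact ⟨_, ⟨z, hz, rfl⟩, fun w hw => htrans h1 hw, fun w hw => htrans h2 hw⟩) (by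
      rintro _ ⟨x, hx, rfl⟩
      refine ⟨?_, fun y hy z hz => htrans hy hz⟩
      rw [isCompact_iff_ultrafilter_le_nhds]
      intro f hf
      refine ⟨x, subset_closure rfl, fun s hs => ?_⟩
      obtain ⟨V, hVs, hV, hxV⟩ := mem_nhds_iff.1 hs
      refine Filter.mem_of_superset (Filter.le_principal_iff.1 hf) (Set.Subset.trans ?_ hVs)
      intro y hy
      obtain ⟨_, h1, rfl⟩ := mem_closure_iff.1 hy V hV hxV
      exact h1) (closure d)ᶜ isClosed_closure.isOpen_compl (by
      intro z hz hzd
      obtain ⟨x, hx, hxz⟩ := hc z hzd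
      exact hxz (hz _ ⟨x, hx, rfl⟩))
  exact hS (subset_closure rfl : x ∈ closure {x}) (subset_closure hx)

/-- A directed set is irreducible, and the generic point of its closure is the required limit. -/
theorem familyP_eq : familyP D = familyV D := by
  refine Set.eq_univ_of_forall fun ν A hP hs => ?_
  refine mem_of_directed_limits D hs (fun d hn hd => ?_) ν
  have := hP.2
  have hirr : IsIrreducible d := by
    refine ⟨hn, fun U V hU hV ⟨x, hx, hxU⟩ ⟨y, hy, hyV⟩ => ?_⟩
    obtain ⟨z, hz, h1, h2⟩ := hd x hx y hy
    obtain ⟨_, hzU, rfl⟩ := mem_closure_iff.1 h1 U hU hxU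
    obtain ⟨_, hzV, rfl⟩ := mem_closure_iff.1 h2 V hV hyV
    exact ⟨_, hz, hzU, hzV⟩
  obtain ⟨z, hz⟩ := QuasiSober.sober hirr.closure isClosed_closure
  refine ⟨z, ?_, fun x hx => ?_⟩
  · rw [← hz.def]
    exact subset_closure rfl
  · rw [hz.def]
    exact subset_closure hx

end Families

/-! ### The Kegelspitze of valuations -/

/-- The unit interval as a pointed barycentric algebra. -/
noncomputable def unitInterval.pointedBarycentricAlgebra : PointedBarycentricAlgebra I where
  conv r a b := ⟨r * a + (1 - r) * b,
    add_nonneg (mul_nonneg r.2.1 a.2.1) (mul_nonneg (sub_nonneg.2 r.2.2) b.2.1), by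
      nlinarith [r.2.1, r.2.2, a.2.2, b.2.2]⟩
  conv_one a b := by ext; simp
  conv_symm r a b := by
    ext
    change (r : ℝ) * a + (1 - r) * b = (1 - r) * b + (1 - (1 - r)) * a
    ring
  conv_self r a := by
    ext
    ring
  conv_assoc p r q a b c hp hr hq := by
    ext
    simp only [Set.Icc.coe_mul]
    have hp' : (p : ℝ) < 1 := hp
    have hr' : (r : ℝ) < 1 := hr
    have h : (1 : ℝ) - p * r ≠ 0 := by nlinarith [p.2.1, r.2.1]
    rw [eq_div_iff h] at hq
    linear_combination ((c : ℝ) - b) * hq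
  bot := 0

namespace SubVal

open Filter

variable {X : Type u} [TopologicalSpace X]

/-- Convex combinations of valuations. -/
noncomputable def conv (r : I) (μ ν : SubVal X) : SubVal X where
  toFun U := unitInterval.pointedBarycentricAlgebra.conv r (μ U) (ν U)
  scottContinuous := by
    intro e hen hed W hW
    have h1 := tendsto_of_isLUB (fun _ _ h => μ.mono h) hen (μ.scottContinuous hen hed hW)
    have h2 := tendsto_of_isLUB (fun _ _ h => ν.mono h) hen (ν.scottContinuous hen hed hW)
    refine isLUB_of_tendsto (fun U V h => ?_) hen hed
      ((h1.const_mul (r : ℝ)).add (h2.const_mul (1 - (r : ℝ))))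
    exact add_le_add (mul_le_mul_of_nonneg_left (μ.coe_mono h) r.2.1)
      (mul_le_mul_of_nonneg_left (ν.coe_mono h) (sub_nonneg.2 r.2.2))
  strict := by
    ext
    change (r : ℝ) * μ ⊥ + (1 - r) * ν ⊥ = 0
    rw [μ.coe_strict, ν.coe_strict]
    ring
  modular U V := by
    change ((r : ℝ) * μ U + (1 - r) * ν U) + (r * μ V + (1 - r) * ν V) =
      (r * μ (U ⊔ V) + (1 - r) * ν (U ⊔ V)) + (r * μ (U ⊓ V) + (1 - r) * ν (U ⊓ V))
    linear_combination (r : ℝ) * μ.modular U V + (1 - (r : ℝ)) * ν.modular U V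

theorem conv_apply (r : I) (μ ν : SubVal X) (U : Opens X) :
    (conv r μ ν U : ℝ) = r * μ U + (1 - r) * ν U := rfl

/-- The zero valuation. -/
def zero : SubVal X where
  toFun _ := 0
  scottContinuous := ScottContinuous.const 0
  strict := rfl
  modular _ _ := rfl

theorem zero_apply (U : Opens X) : ((zero : SubVal X) U : ℝ) = 0 := rfl

theorem ext_coe {μ ν : SubVal X} (h : ∀ U, (μ U : ℝ) = ν U) : μ = ν :=
  SubVal.ext (funext fun U => Subtype.ext (h U))

/-- The pointed barycentric algebra of valuations. -/
noncomputable def pointedBarycentricAlgebra : PointedBarycentricAlgebra (SubVal X) where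
  conv := conv
  conv_one μ ν := SubVal.ext (funext fun U =>
    unitInterval.pointedBarycentricAlgebra.conv_one (μ U) (ν U))
  conv_symm r μ ν := SubVal.ext (funext fun U =>
    unitInterval.pointedBarycentricAlgebra.conv_symm r (μ U) (ν U))
  conv_self r μ := SubVal.ext (funext fun U =>
    unitInterval.pointedBarycentricAlgebra.conv_self r (μ U))
  conv_assoc p r q μ ν ρ hp hr hq := SubVal.ext (funext fun U =>
    unitInterval.pointedBarycentricAlgebra.conv_assoc p r q (μ U) (ν U) (ρ U) hp hr hq)
  bot := zero

variable {P : Type v} [Preorder P]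

theorem isLUB_of_tendsto {φ : P → SubVal X} (hφ : Monotone φ) {d : Set P} (hn : d.Nonempty)
    (hd : DirectedOn (· ≤ ·) d) {s : SubVal X}
    (h : ∀ U, Tendsto (fun i : d => (φ i U : ℝ)) atTop (𝓝 (s U : ℝ))) : IsLUB (φ '' d) s := by
  refine isLUB_of_forall fun U => ?_
  rw [← Set.image_comp]
  exact _root_.isLUB_of_tendsto (φ := (fun ν : SubVal X => ν U) ∘ φ)
    (fun _ _ hij => hφ hij U) hn hd (h U)

/-- The Kegelspitze of valuations. -/
noncomputable def kegelspitze : Kegelspitze (SubVal X) where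
  toPointedBarycentricAlgebra := pointedBarycentricAlgebra
  isDcpo := isDcpo
  conv_scottContinuous r := by
    have hr : (0 : ℝ) ≤ 1 - r := sub_nonneg.2 r.2.2
    intro d hn hd s hs
    refine isLUB_of_tendsto (fun x y h U => ?_) hn hd fun U => ?_
    · change (r : ℝ) * x.1 U + (1 - r) * x.2 U ≤ r * y.1 U + (1 - r) * y.2 U
      exact add_le_add (mul_le_mul_of_nonneg_left (h.1 U) r.2.1)
        (mul_le_mul_of_nonneg_left (h.2 U) hr)
    · have h1 := (ScottContinuous.fst (α := SubVal X) (β := SubVal X)).comp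
        (scottContinuous_apply U)
      have h2 := (ScottContinuous.snd (α := SubVal X) (β := SubVal X)).comp
        (scottContinuous_apply U)
      exact ((tendsto_of_isLUB h1.monotone hn (h1 hn hd hs)).const_mul (r : ℝ)).add
        ((tendsto_of_isLUB h2.monotone hn (h2 hn hd hs)).const_mul (1 - (r : ℝ)))
  smul_scottContinuous := by
    intro d hn hd s hs
    refine isLUB_of_tendsto (fun x y h U => ?_) hn hd fun U => ?_
    · change (x.1 : ℝ) * x.2 U + (1 - x.1) * 0 ≤ y.1 * y.2 U + (1 - y.1) * 0
      rw [mul_zero, mul_zero, add_zero, add_zero]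
      exact mul_le_mul h.1 (h.2 U) (x.2 U).2.1 y.1.2.1
    · have h1 := ScottContinuous.fst (α := I) (β := SubVal X)
      have h2 := (ScottContinuous.snd (α := I) (β := SubVal X)).comp (scottContinuous_apply U)
      have h3 := (tendsto_of_isLUB h1.monotone hn (h1 hn hd hs)).mul
        (tendsto_of_isLUB h2.monotone hn (h2 hn hd hs))
      have h4 : ∀ x : I × SubVal X, ((pointedBarycentricAlgebra.conv x.1 x.2
          pointedBarycentricAlgebra.bot : SubVal X) U : ℝ) = x.1 * x.2 U := fun x => by
        change (x.1 : ℝ) * x.2 U + (1 - x.1) * 0 = _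
        rw [mul_zero, add_zero]
      simp only [h4]
      exact h3

end SubVal

/-! ### Kegelspitzen -/

namespace Kegelspitze

variable {K : Type u} [PartialOrder K] (κ : Kegelspitze K)

theorem monotone_conv (r : I) : Monotone fun x : K × K => κ.conv r x.1 x.2 :=
  (κ.conv_scottContinuous r).monotone

theorem conv_zero (a b : K) : κ.conv 0 a b = b := by
  rw [κ.conv_symm, symm_zero, κ.conv_one]

/-- Monotonicity of scalar multiplication in the scalar, between `0` and `1`, makes the
distinguished element least. -/
theorem bot_le (a : K) : κ.bot ≤ a := by
  have h : κ.conv 0 a κ.bot ≤ κ.conv 1 a κ.bot :=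
    κ.smul_scottContinuous.monotone
      (show ((0 : I), a) ≤ ((1 : I), a) from ⟨unitInterval.nonneg', le_rfl⟩)
  rwa [κ.conv_zero, κ.conv_one] at h

theorem scottContinuous_conv_left (r : I) (b : K) : ScottContinuous fun a => κ.conv r a b :=
  ScottContinuous.comp (g := fun x : K × K => κ.conv r x.1 x.2) (f := fun a => (a, b))
    (ScottContinuous.prodMk ScottContinuous.id (ScottContinuous.const b))
    (κ.conv_scottContinuous r)

theorem scottContinuous_conv_right (r : I) (a : K) : ScottContinuous fun b => κ.conv r a b :=
  ScottContinuous.comp (g := fun x : K × K => κ.conv r x.1 x.2) (f := fun b => (a, b))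
    (ScottContinuous.prodMk (ScottContinuous.const a) ScottContinuous.id)
    (κ.conv_scottContinuous r)

/-- Scott continuity in the scalar applies because `1` is the directed supremum of the `r < 1`. -/
theorem le_of_forall_smul_le {a k : K} (h : ∀ r : I, r < 1 → κ.conv r a κ.bot ≤ k) : a ≤ k := by
  have hs : ScottContinuous fun r : I => κ.conv r a κ.bot :=
    ScottContinuous.comp (g := fun x : I × K => κ.conv x.1 x.2 κ.bot) (f := fun r => (r, a))
      (ScottContinuous.prodMk ScottContinuous.id (ScottContinuous.const a))
      κ.smul_scottContinuous
  have hl : IsLUB (Set.Iio (1 : I)) 1 := by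
    refine ⟨fun x hx => le_of_lt hx, fun b hb => ?_⟩
    by_contra! hlt
    obtain ⟨c, hbc, hc⟩ := exists_between hlt
    exact absurd (hb hc) (not_le.2 hbc)
  have h1 := hs (d := Set.Iio 1) ⟨0, Set.mem_Iio.2 zero_lt_one⟩ (fun x hx y hy =>
    ⟨max x y, Set.mem_Iio.2 (max_lt hx hy), le_max_left _ _, le_max_right _ _⟩) hl
  have h2 : κ.conv 1 a κ.bot ≤ k := h1.2 (by rintro _ ⟨r, hr, rfl⟩; exact h r hr)
  rwa [κ.conv_one] at h2

end Kegelspitze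

/-! ### The universal property of the Kegelspitze of valuations -/

section Extension

open scoped NNReal

variable {D : Dom.{u}} {K : Type w} [PartialOrder K] (κ : Kegelspitze K) {f : D → K}

/-- The stochastic order yields a transport, and barycenters increase along transports. In
particular the barycenter depends only on the valuation, not on the weights. -/
theorem bary_le_bary (hf : ScottContinuous f) {t s : SubWeights D}
    (h : simpleVal t ≤ simpleVal s) :
    bary κ.toPointedBarycentricAlgebra f t.1 ≤ bary κ.toPointedBarycentricAlgebra f s.1 :=
  (hallCondition_of_le h).flow.bary_le κ.monotone_conv κ.bot_le hf.monotone s.2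

theorem mass_univ_mapDomain (φ : D → D) (t : D →₀ ℝ≥0) :
    mass Set.univ (t.mapDomain φ) = mass Set.univ t := by
  rw [mass_mapDomain, Set.preimage_univ]

/-- A barycenter is the supremum of the barycenters obtained by moving the points down. -/
theorem bary_le_of_forall_mapDomain (hf : ScottContinuous f) (t u : D →₀ ℝ≥0)
    (htu : mass Set.univ u + mass Set.univ t ≤ 1) {k : K}
    (h : ∀ φ : D → D, (∀ x ∈ t.support, WayBelow (φ x) x) →
      bary κ.toPointedBarycentricAlgebra f (u + t.mapDomain φ) ≤ k) :
    bary κ.toPointedBarycentricAlgebra f (u + t) ≤ k := by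
  classical
  -- The points are moved down one at a time; `u` collects those that stay fixed. As a function of
  -- the moved point the barycenter is Scott-continuous.
  induction t using Finsupp.induction generalizing u with
  | zero => simpa using h id (by simp)
  | single_add x c t hx hc ih =>
    rw [map_add, mass_single, if_pos (Set.mem_univ _)] at htu
    have hsupp : (Finsupp.single x c + t).support = insert x t.support := by
      rw [Finsupp.support_add_eq, Finsupp.support_single x hc, Finset.insert_eq]
      rw [Finsupp.support_single x hc]
      simpa using hx
    rw [← add_assoc]
    refine ih (u + Finsupp.single x c) ?_ fun φ hφ => ?_
    · rw [map_add, mass_single, if_pos (Set.mem_univ _), add_assoc]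
      exact htu
    · rw [add_right_comm]
      obtain ⟨r, b, hb⟩ := exists_bary_add_single (κ := κ.toPointedBarycentricAlgebra) (f := f)
        (u := u + t.mapDomain φ) (c := c) (by
          rw [map_add, mass_univ_mapDomain, add_assoc, add_comm _ c]
          exact htu)
      rw [hb]
      obtain ⟨hn, hd, hl⟩ := D.isContinuous.wayBelow x
      refine ((hf.comp (κ.scottContinuous_conv_left r b)) hn hd hl).2 ?_
      rintro _ ⟨y, hy, rfl⟩
      change κ.conv r (f y) b ≤ k
      rw [← hb]
      have h1 := h (Function.update φ x y) (by
        rw [hsupp]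
        intro z hz
        by_cases hzx : z = x
        · subst hzx
          simpa using hy
        · rw [Function.update_of_ne hzx]
          exact hφ z ((Finset.mem_insert.1 hz).resolve_left hzx))
      have h2 : t.mapDomain (Function.update φ x y) = t.mapDomain φ :=
        Finsupp.mapDomain_congr fun z hz => by
          rw [Function.update_of_ne]
          rintro rfl
          exact hx hz
      rw [Finsupp.mapDomain_add, Finsupp.mapDomain_single, Function.update_self, h2] at h1
      rwa [add_assoc, add_comm (t.mapDomain φ)]

theorem eq_zero_of_mass_univ {t : D →₀ ℝ≥0} (h : mass Set.univ t = 0) : t = 0 := by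
  rw [mass_eq_sum] at h
  ext x
  by_contra hx
  have hx' : t x ≠ 0 := fun h => hx (by rw [h, Finsupp.zero_apply])
  exact hx' (Finset.sum_eq_zero_iff.1 h x (by simp [hx']))

theorem smul_mapDomain_mass_le {t : SubWeights D} {r : I} (φ : D → D) :
    mass Set.univ (toNNReal r • t.1.mapDomain φ) ≤ 1 := by
  rw [map_smul, mass_univ_mapDomain, smul_eq_mul]
  have hr : toNNReal r ≤ 1 := r.2.2
  exact mul_le_one' hr t.2

/-- Moving points down brings every preimage of `J` into `reach J`; the factor `r < 1` makes the
inequality strict because `J` has positive mass. -/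
theorem strictlyBelow_smul_mapDomain {t : SubWeights D} {φ : D → D}
    (hφ : ∀ x ∈ t.1.support, WayBelow (φ x) x) {r : I} (hr : r < 1) :
    StrictlyBelow ⟨toNNReal r • t.1.mapDomain φ, smul_mapDomain_mass_le φ⟩ (simpleVal t) := by
  classical
  intro J hJ hne
  rw [simpleVal_apply, NNReal.coe_lt_coe]
  change mass (J : Set D) (toNNReal r • t.1.mapDomain φ) < _
  have hr' : toNNReal r < 1 := hr
  have h0 : 0 < mass (φ ⁻¹' (J : Set D)) t.1 := by
    obtain ⟨x, hx⟩ := hne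
    rw [pos_iff_ne_zero, ← mass_mapDomain]
    intro h0
    have hx' : t.1.mapDomain φ x ≠ 0 := by
      have := Finsupp.mem_support_iff.1 (hJ hx)
      rw [Finsupp.smul_apply, smul_eq_mul] at this
      exact right_ne_zero_of_mul this
    rw [mass_eq_sum, Finset.sum_eq_zero_iff] at h0
    exact hx' (h0 x (by simp [hx, hx']))
  rw [map_smul, mass_mapDomain, smul_eq_mul]
  refine (mul_lt_of_lt_one_left h0 hr').trans_le (mass_mono t.1 fun x hx hx0 => ?_)
  exact ⟨φ x, hx, hφ x (Finsupp.mem_support_iff.2 hx0)⟩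

theorem bary_smul {t : SubWeights D} (r : I) :
    bary κ.toPointedBarycentricAlgebra f (toNNReal r • t.1) =
      κ.conv r (bary κ.toPointedBarycentricAlgebra f t.1) κ.bot := by
  have := bary_conv (κ := κ.toPointedBarycentricAlgebra) (f := f) t.2 (s := 0) (by simp) r
  rwa [smul_zero, add_zero, bary_zero] at this

theorem bary_le_of_forall_strictlyBelow (hf : ScottContinuous f) (t : SubWeights D) {k : K}
    (h : ∀ s, StrictlyBelow s (simpleVal t) → bary κ.toPointedBarycentricAlgebra f s.1 ≤ k) :
    bary κ.toPointedBarycentricAlgebra f t.1 ≤ k := by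
  have := bary_le_of_forall_mapDomain κ hf t.1 0 (by simpa using t.2) (k := k) (by
    intro φ hφ
    rw [zero_add]
    refine κ.le_of_forall_smul_le fun r hr => ?_
    have h1 := h _ (strictlyBelow_smul_mapDomain hφ hr)
    have h2 := bary_smul κ (f := f)
      (t := ⟨t.1.mapDomain φ, by rw [mass_univ_mapDomain]; exact t.2⟩) r
    exact h2 ▸ h1)
  rwa [zero_add] at this

theorem exists_isLUB_bary (hf : ScottContinuous f) (ν : SubVal (WithScott D)) :
    ∃ a, IsLUB ((fun t : SubWeights D => bary κ.toPointedBarycentricAlgebra f t.1) ''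
      {t | StrictlyBelow t ν}) a := by
  refine κ.isDcpo _ ?_ ?_
  · obtain ⟨_, t, ht, -⟩ := approximants_nonempty ν
    exact ⟨_, t, ht, rfl⟩
  · rintro _ ⟨t₁, h₁, rfl⟩ _ ⟨t₂, h₂, rfl⟩
    obtain ⟨t, ht, h1, h2⟩ := exists_strictlyBelow_ge ν h₁ h₂
    exact ⟨_, ⟨t, ht, rfl⟩, bary_le_bary κ hf h1, bary_le_bary κ hf h2⟩

/-- The extension of a Scott-continuous map into a Kegelspitze to all valuations. -/
noncomputable def extend (hf : ScottContinuous f) (ν : SubVal (WithScott D)) : K :=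
  (exists_isLUB_bary κ hf ν).choose

theorem isLUB_extend (hf : ScottContinuous f) (ν : SubVal (WithScott D)) :
    IsLUB ((fun t : SubWeights D => bary κ.toPointedBarycentricAlgebra f t.1) ''
      {t | StrictlyBelow t ν}) (extend κ hf ν) :=
  (exists_isLUB_bary κ hf ν).choose_spec

/-- One inequality is monotonicity of barycenters; the other says that weights strictly below
`simpleVal t` already approximate its barycenter. -/
theorem extend_simpleVal (hf : ScottContinuous f) (t : SubWeights D) :
    extend κ hf (simpleVal t) = bary κ.toPointedBarycentricAlgebra f t.1 := by
  refine le_antisymm ((isLUB_extend κ hf _).2 ?_)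
    (bary_le_of_forall_strictlyBelow κ hf t fun s hs => (isLUB_extend κ hf _).1 ⟨s, hs, rfl⟩)
  rintro _ ⟨s, hs, rfl⟩
  exact bary_le_bary κ hf hs.simpleVal_le

theorem extend_dirac (hf : ScottContinuous f) (x : D) :
    extend κ hf (SubVal.dirac (WithScott.toScott x)) = f x := by
  rw [← simpleVal_single, extend_simpleVal, bary_single]

/-- Weights strictly below a directed supremum are strictly below some member, so no new barycenters
appear at the supremum. -/
theorem scottContinuous_extend (hf : ScottContinuous f) : ScottContinuous (extend κ hf) := by
  intro d hn hd s hs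
  constructor
  · rintro _ ⟨ν, hν, rfl⟩
    refine (isLUB_extend κ hf ν).2 ?_
    rintro _ ⟨t, ht, rfl⟩
    exact (isLUB_extend κ hf s).1 ⟨t, StrictlyBelow.mono ht (hs.1 hν), rfl⟩
  · intro b hb
    refine (isLUB_extend κ hf s).2 ?_
    rintro _ ⟨t, ht, rfl⟩
    obtain ⟨ν, hν, htν⟩ := StrictlyBelow.exists_mem hn hd hs ht
    exact ((isLUB_extend κ hf ν).1 ⟨t, htν, rfl⟩).trans (hb ⟨ν, hν, rfl⟩)

/-- Scott-continuous maps are determined by their values on simple valuations. -/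
theorem eq_of_forall_simpleVal {P : Type w} [PartialOrder P] {g h : SubVal (WithScott D) → P}
    (hg : ScottContinuous g) (hh : ScottContinuous h)
    (heq : ∀ t, g (simpleVal t) = h (simpleVal t)) (ν : SubVal (WithScott D)) : g ν = h ν := by
  have h1 := hg (approximants_nonempty ν) (directedOn_approximants ν) (isLUB_approximants ν)
  have h2 := hh (approximants_nonempty ν) (directedOn_approximants ν) (isLUB_approximants ν)
  refine h1.unique (?_ : IsLUB _ _)
  rwa [approximants, Set.image_image, funext heq, ← Set.image_image h simpleVal]

theorem simpleVal_conv (r : I) (t s : SubWeights D) :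
    simpleVal ⟨toNNReal r • t.1 + toNNReal (σ r) • s.1, mass_conv_le t.2 s.2 r⟩ =
      SubVal.conv r (simpleVal t) (simpleVal s) := by
  refine SubVal.ext_coe fun U => ?_
  rw [simpleVal_apply, SubVal.conv_apply, simpleVal_apply, simpleVal_apply]
  simp

theorem simpleVal_zero : simpleVal (⟨0, by simp⟩ : SubWeights D) = SubVal.zero :=
  SubVal.ext_coe fun U => by
    rw [simpleVal_apply, SubVal.zero_apply]
    simp

/-- The extension is linear. -/
theorem isBaryLinear_extend (hf : ScottContinuous f) :
    IsBaryLinear SubVal.pointedBarycentricAlgebra κ.toPointedBarycentricAlgebra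
      (extend κ hf) := by
  constructor
  · change extend κ hf SubVal.zero = κ.bot
    rw [← simpleVal_zero, extend_simpleVal]
    exact bary_zero
  · intro r μ ν
    change extend κ hf (SubVal.conv r μ ν) = _
    -- Separate Scott continuity reduces each argument in turn to simple valuations, where linearity
    -- is `bary_conv`.
    have hs := scottContinuous_extend κ hf
    refine eq_of_forall_simpleVal (g := fun μ => extend κ hf (SubVal.conv r μ ν))
      (h := fun μ => κ.conv r (extend κ hf μ) (extend κ hf ν))
      ((SubVal.kegelspitze.scottContinuous_conv_left r ν).comp hs)
      (hs.comp (κ.scottContinuous_conv_left r _)) (fun t => ?_) μ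
    refine eq_of_forall_simpleVal (g := fun ν => extend κ hf (SubVal.conv r (simpleVal t) ν))
      (h := fun ν => κ.conv r (extend κ hf (simpleVal t)) (extend κ hf ν))
      ((SubVal.kegelspitze.scottContinuous_conv_right r (simpleVal t)).comp hs)
      (hs.comp (κ.scottContinuous_conv_right r _)) (fun s => ?_) ν
    rw [← simpleVal_conv, extend_simpleVal, extend_simpleVal, extend_simpleVal]
    exact bary_conv t.2 s.2 r

/-- Scott-continuous linear maps are determined by their values on Dirac valuations. -/
theorem eq_of_forall_dirac {β : PointedBarycentricAlgebra K} {g h : SubVal (WithScott D) → K}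
    (hg : ScottContinuous g) (hg' : IsBaryLinear SubVal.pointedBarycentricAlgebra β g)
    (hh : ScottContinuous h) (hh' : IsBaryLinear SubVal.pointedBarycentricAlgebra β h)
    (heq : ∀ x : D, g (SubVal.dirac (WithScott.toScott x)) =
      h (SubVal.dirac (WithScott.toScott x))) (ν : SubVal (WithScott D)) : g ν = h ν := by
  classical
  refine eq_of_forall_simpleVal hg hh (fun ⟨t, ht⟩ => ?_) ν
  -- The scalar `c` is carried along since splitting off a point rescales the remaining weights.
  have key : ∀ (t : D →₀ ℝ≥0) (c : ℝ≥0) (hct : mass Set.univ (c • t) ≤ 1),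
      g (simpleVal ⟨c • t, hct⟩) = h (simpleVal ⟨c • t, hct⟩) := by
    intro t
    induction t using Finsupp.induction with
    | zero =>
      intro c hct
      have : simpleVal (⟨c • 0, hct⟩ : SubWeights D) = SubVal.zero := by
        rw [← simpleVal_zero]
        congr 2
        exact smul_zero c
      rw [this]
      exact hg'.1.trans hh'.1.symm
    | single_add x a t hx ha ih =>
      intro c hct
      have hct' := hct
      rw [map_smul, map_add, mass_single, if_pos (Set.mem_univ _), smul_eq_mul, mul_add] at hct'
      have hca : c * a ≤ 1 := le_self_add.trans hct'
      let r : I := ⟨(c * a : ℝ≥0), NNReal.coe_nonneg _, by exact_mod_cast hca⟩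
      have hr : toNNReal r = c * a := rfl
      have hsum := toNNReal_add_symm r
      rw [hr] at hsum
      have hle : c * mass Set.univ t ≤ toNNReal (σ r) := by
        rw [← hsum] at hct'
        exact le_of_add_le_add_left hct'
      -- The new scalar is `c / (1 - c * a)`; if the denominator vanishes, no mass remains and `0`
      -- serves.
      obtain ⟨c', hc', hcc⟩ : ∃ c' : ℝ≥0, c' * mass Set.univ t ≤ 1 ∧
          toNNReal (σ r) • (c' • t) = c • t := by
        rcases eq_or_ne (toNNReal (σ r)) 0 with h0 | h0
        · refine ⟨0, by simp, ?_⟩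
          rw [h0] at hle ⊢
          rw [zero_smul]
          have hz : c * mass Set.univ t = 0 := le_antisymm hle bot_le
          rw [← smul_eq_mul, ← map_smul] at hz
          exact (eq_zero_of_mass_univ hz).symm
        · refine ⟨c / toNNReal (σ r), ?_, ?_⟩
          · rw [div_mul_eq_mul_div]
            exact div_le_one_of_le₀ hle _root_.bot_le
          · rw [smul_smul, mul_div_cancel₀ _ h0]
      have hct2 : mass Set.univ (c' • t) ≤ 1 := by rwa [map_smul, smul_eq_mul]
      have e : simpleVal ⟨c • (Finsupp.single x a + t), hct⟩ =
          SubVal.conv r (SubVal.dirac (WithScott.toScott x)) (simpleVal ⟨c' • t, hct2⟩) := by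
        rw [← simpleVal_single, ← simpleVal_conv]
        congr 2
        rw [hcc, hr, smul_add, Finsupp.smul_single, Finsupp.smul_single, smul_eq_mul,
          smul_eq_mul, mul_one]
      rw [e]
      refine (hg'.2 r _ _).trans (Eq.trans ?_ (hh'.2 r _ _).symm)
      rw [heq, ih]
  have := key t 1 (by rwa [one_smul])
  simpa only [one_smul] using this

end Extension

/-! ### Integration with respect to valuations -/

section Riemann

variable {φ : ℝ → ℝ}

theorem Antitone.integral_le_riemann (hφ : Antitone φ) {n : ℕ} (hn : 0 < n) :
    ∫ t in (0 : ℝ)..1, φ t ≤ (n : ℝ)⁻¹ * ∑ i ∈ Finset.range n, φ (i / n) := by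
  have hn' : (n : ℝ) ≠ 0 := by positivity
  have h1 := AntitoneOn.integral_le_sum (f := fun x => φ (x / n)) (x₀ := 0) (a := n)
    (fun x _ y _ hxy => hφ (by gcongr))
  rw [intervalIntegral.integral_comp_div φ hn'] at h1
  simp only [zero_div, zero_add, div_self hn', smul_eq_mul] at h1
  rw [le_inv_mul_iff₀ (by positivity)]
  exact h1

theorem Antitone.riemann_le_integral (hφ : Antitone φ) {n : ℕ} (hn : 0 < n) :
    (n : ℝ)⁻¹ * ∑ i ∈ Finset.range n, φ ((i + 1 : ℕ) / n) ≤ ∫ t in (0 : ℝ)..1, φ t := by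
  have hn' : (n : ℝ) ≠ 0 := by positivity
  have h1 := AntitoneOn.sum_le_integral (f := fun x => φ (x / n)) (x₀ := 0) (a := n)
    (fun x _ y _ hxy => hφ (by gcongr))
  rw [intervalIntegral.integral_comp_div φ hn'] at h1
  simp only [zero_div, zero_add, div_self hn', smul_eq_mul] at h1
  rw [inv_mul_le_iff₀ (by positivity)]
  exact h1

end Riemann

namespace SubVal

open Filter

variable {X : Type u} [TopologicalSpace X] (g : X → I)

theorem antitone_integrand (ν : SubVal X) :
    Antitone fun t : ℝ => (ν (Opens.interior {x | t < (g x : ℝ)}) : ℝ) :=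
  fun _ _ h => ν.coe_mono (interior_mono fun _ hx => lt_of_le_of_lt h hx)

theorem intervalIntegrable (ν : SubVal X) : IntervalIntegrable
    (fun t : ℝ => (ν (Opens.interior {x | t < (g x : ℝ)}) : ℝ)) MeasureTheory.volume 0 1 :=
  (antitone_integrand g ν).intervalIntegrable

theorem integral_mem (ν : SubVal X) : ν.integral g ∈ I := by
  constructor
  · exact intervalIntegral.integral_nonneg zero_le_one fun t _ => (ν _).2.1
  · have := intervalIntegral.integral_mono_on zero_le_one (intervalIntegrable g ν)
      (intervalIntegrable_const (c := (1 : ℝ))) fun t _ => (ν _).2.2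
    rw [intervalIntegral.integral_const] at this
    simpa [integral] using this

theorem integral_mono {μ ν : SubVal X} (h : μ ≤ ν) : μ.integral g ≤ ν.integral g :=
  intervalIntegral.integral_mono_on zero_le_one (intervalIntegrable g μ) (intervalIntegrable g ν)
    fun _ _ => h _

/-- The integral is Scott-continuous in the valuation. -/
theorem scottContinuous_integral :
    ScottContinuous fun ν : SubVal X => (⟨ν.integral g, integral_mem g ν⟩ : I) := by
  intro d hn hd s hs
  constructor
  · rintro _ ⟨ν, hν, rfl⟩
    exact integral_mono g (hs.1 hν)
  · intro b hb
    change s.integral g ≤ b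
    refine le_of_forall_pos_le_add fun ε hε => ?_
    -- Riemann sums with `n` steps reduce the integral to finitely many values. Half of `ε` bounds
    -- the gap between upper and lower sums, half the error in these values.
    obtain ⟨n, hn0, hnε⟩ : ∃ n : ℕ, 0 < n ∧ (n : ℝ)⁻¹ ≤ ε / 2 := by
      obtain ⟨n, hn⟩ := exists_nat_gt (ε / 2)⁻¹
      have hpos : (0 : ℝ) < n := lt_trans (by positivity) hn
      exact ⟨n, by exact_mod_cast hpos, (inv_le_comm₀ (by positivity) hpos).1 hn.le⟩
    have hn' : (0 : ℝ) < n := by exact_mod_cast hn0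
    have := DirectedOn.neBot hn hd
    let φ : SubVal X → ℝ → ℝ := fun ν t => ν (Opens.interior {x | t < (g x : ℝ)})
    have hev : ∀ᶠ ν : d in atTop, ∀ i ∈ Finset.range n,
        φ s ((i + 1 : ℕ) / n) - ε / 2 < φ ν.1 ((i + 1 : ℕ) / n) := by
      rw [eventually_all_finset]
      intro i _
      exact (tendsto_apply hn hd hs _).eventually_const_lt (sub_lt_self _ (half_pos hε))
    obtain ⟨ν, hν⟩ := hev.exists
    have h1 := (antitone_integrand g s).integral_le_riemann hn0
    have h2 := (antitone_integrand g ν.1).riemann_le_integral hn0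
    -- Upper and lower sums differ only in their end terms, which lie in `[0, 1]`.
    have h3 : ∑ i ∈ Finset.range n, φ s (i / n) ≤
        1 + ∑ i ∈ Finset.range n, φ s ((i + 1 : ℕ) / n) := by
      have e1 := Finset.sum_range_succ (fun i : ℕ => φ s (i / n)) n
      have e2 := Finset.sum_range_succ' (fun i : ℕ => φ s (i / n)) n
      have e3 : 0 ≤ φ s ((n : ℕ) / n) := (s _).2.1
      have e4 : φ s ((0 : ℕ) / n) ≤ 1 := (s _).2.2
      linarith
    have h4 : ∑ i ∈ Finset.range n, φ s ((i + 1 : ℕ) / n) ≤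
        ∑ i ∈ Finset.range n, φ ν.1 ((i + 1 : ℕ) / n) + n * (ε / 2) := by
      have : ∑ i ∈ Finset.range n, φ s ((i + 1 : ℕ) / n) ≤
          ∑ i ∈ Finset.range n, (φ ν.1 ((i + 1 : ℕ) / n) + ε / 2) :=
        Finset.sum_le_sum fun i hi => by linarith [hν i hi]
      simpa [Finset.sum_add_distrib] using this
    have h5 : (n : ℝ)⁻¹ * ∑ i ∈ Finset.range n, φ s (i / n) ≤ (n : ℝ)⁻¹ * (1 +
        (∑ i ∈ Finset.range n, φ ν.1 ((i + 1 : ℕ) / n) + n * (ε / 2))) :=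
      mul_le_mul_of_nonneg_left (h3.trans (by linarith)) (by positivity)
    have h6 : (n : ℝ)⁻¹ * (1 + (∑ i ∈ Finset.range n, φ ν.1 ((i + 1 : ℕ) / n) + n * (ε / 2))) =
        (n : ℝ)⁻¹ + (n : ℝ)⁻¹ * ∑ i ∈ Finset.range n, φ ν.1 ((i + 1 : ℕ) / n) + ε / 2 := by
      field_simp
      ring
    have h7 : ν.1.integral g ≤ b := hb ⟨ν.1, ν.2, rfl⟩
    have h8 : s.integral g ≤ (n : ℝ)⁻¹ * ∑ i ∈ Finset.range n, φ s (i / n) := h1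
    have h9 : (n : ℝ)⁻¹ * ∑ i ∈ Finset.range n, φ ν.1 ((i + 1 : ℕ) / n) ≤ ν.1.integral g := h2
    linarith

theorem isBaryLinear_integral : IsBaryLinear pointedBarycentricAlgebra
    unitInterval.pointedBarycentricAlgebra
    fun ν : SubVal X => (⟨ν.integral g, integral_mem g ν⟩ : I) := by
  constructor
  · ext
    change ∫ t in (0 : ℝ)..1, ((zero : SubVal X) _ : ℝ) = 0
    simp [zero_apply]
  · intro r μ ν
    ext
    change ∫ t in (0 : ℝ)..1, (conv r μ ν _ : ℝ) = r * μ.integral g + (1 - r) * ν.integral g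
    simp only [conv_apply]
    rw [intervalIntegral.integral_add ((intervalIntegrable g μ).const_mul _)
      ((intervalIntegrable g ν).const_mul _), intervalIntegral.integral_const_mul,
      intervalIntegral.integral_const_mul]
    rfl

variable {g}

theorem integral_dirac (hg : ∀ t : ℝ, IsOpen {x | t < (g x : ℝ)}) (x : X) :
    (dirac x).integral g = g x := by
  have h1 : ∀ t : ℝ, (dirac x (Opens.interior {y | t < (g y : ℝ)}) : ℝ) =
      (Set.Iio (g x : ℝ)).indicator (fun _ => (1 : ℝ)) t := by
    intro t
    have : x ∈ Opens.interior {y | t < (g y : ℝ)} ↔ t < g x := by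
      rw [← SetLike.mem_coe, Opens.coe_interior, (hg t).interior_eq]
      rfl
    by_cases ht : t < g x
    · simp [dirac, this, ht]
    · simp [dirac, this, ht]
  have h2 : Set.Iio (g x : ℝ) ∩ Set.Ioc 0 1 = Set.Ioo 0 (g x : ℝ) := by
    ext t
    simp only [Set.mem_inter_iff, Set.mem_Iio, Set.mem_Ioc, Set.mem_Ioo]
    constructor
    · tauto
    · exact fun h => ⟨h.2, h.1, h.2.le.trans (g x).2.2⟩
  rw [integral]
  simp only [h1]
  rw [intervalIntegral.integral_of_le zero_le_one,
    MeasureTheory.integral_indicator_const _ measurableSet_Iio,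
    MeasureTheory.measureReal_restrict_apply measurableSet_Iio, h2,
    Real.volume_real_Ioo_of_le (g x).2.1]
  simp

end SubVal

/-! ### The Kleisli extension as an integral. -/

section Kleisli

variable {D : Dom.{u}}

theorem isOpen_lt_of_scottContinuous {g : D → I} (hg : ScottContinuous g) (t : ℝ) :
    IsOpen {x : WithScott D | t < (g (WithScott.ofScott x) : ℝ)} := by
  rw [isOpen_withScott_iff]
  refine ⟨fun x y hxy hx => lt_of_lt_of_le (b := (g x : ℝ)) hx
    (show (g x : ℝ) ≤ g y from hg.monotone hxy), fun d hn hd a ha hat => ?_⟩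
  have h := (unitInterval.isLUB_coe (hn.image _)).2 (hg hn hd ha)
  obtain ⟨_, ⟨_, ⟨b, hb, rfl⟩, rfl⟩, h1, -⟩ := h.exists_between hat
  exact ⟨b, hb, h1⟩

/-- For fixed `U` both sides are Scott-continuous linear maps from valuations to the unit interval,
and they agree at Dirac valuations. -/
theorem extend_apply {Y : Type u} [TopologicalSpace Y] {f : D → SubVal Y} (hf : ScottContinuous f)
    (ν : SubVal (WithScott D)) (U : Opens Y) :
    (extend SubVal.kegelspitze hf ν U : ℝ) =
      ν.integral fun x => f (WithScott.ofScott x) U := by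
  have hfU : ScottContinuous fun x => f x U := hf.comp (SubVal.scottContinuous_apply U)
  have hl := isBaryLinear_extend SubVal.kegelspitze hf
  refine congrArg Subtype.val (eq_of_forall_dirac (β := unitInterval.pointedBarycentricAlgebra)
    (g := fun ν => extend SubVal.kegelspitze hf ν U)
    (h := fun ν => ⟨ν.integral fun x => f (WithScott.ofScott x) U, SubVal.integral_mem _ ν⟩)
    ((scottContinuous_extend SubVal.kegelspitze hf).comp (SubVal.scottContinuous_apply U))
    ⟨congrArg (fun ν : SubVal Y => ν U) hl.1,
      fun r μ ν => congrArg (fun ν : SubVal Y => ν U) (hl.2 r μ ν)⟩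
    (SubVal.scottContinuous_integral _) (SubVal.isBaryLinear_integral _) (fun x => ?_) ν)
  ext
  change (extend SubVal.kegelspitze hf (SubVal.dirac (WithScott.toScott x)) U : ℝ) =
    (SubVal.dirac (WithScott.toScott x)).integral fun x => f (WithScott.ofScott x) U
  rw [SubVal.integral_dirac (isOpen_lt_of_scottContinuous hfU), extend_dirac]
  rfl

end Kleisli

/-! ### Algebras and Kegelspitzen -/

section AlgebraKegelspitze

theorem OrderIso.scottContinuous' {α : Type u} {β : Type v} [PartialOrder α] [PartialOrder β]
    (e : α ≃o β) : ScottContinuous e := fun _ _ _ _ ha => e.isLUB_image'.2 ha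

/-- The Dirac valuation at a point of a domain. -/
noncomputable abbrev diracAt {D : Dom.{u}} (x : D) : SubVal (WithScott D) :=
  SubVal.dirac (WithScott.toScott x)

variable {D : Dom.{u}}

theorem scottContinuous_diracAt : ScottContinuous (diracAt (D := D)) := by
  classical
  intro d hn hd a ha
  have hmono : Monotone (diracAt (D := D)) := by
    intro x y hxy U
    by_cases hx : WithScott.toScott x ∈ U
    · simp [diracAt, SubVal.dirac, hx, Opens.mem_of_le hxy hx]
    · simp [diracAt, SubVal.dirac, hx]
  constructor
  · rintro _ ⟨x, hx, rfl⟩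
    exact hmono (ha.1 hx)
  · intro b hb U
    by_cases haU : WithScott.toScott a ∈ U
    · obtain ⟨x, hx, hxU⟩ := (isOpen_withScott_iff.1 U.isOpen).2 d hn hd a ha haU
      have h1 : diracAt a U = 1 := if_pos haU
      have h2 : diracAt x U = 1 := if_pos hxU
      rw [h1, ← h2]
      exact hb ⟨x, hx, rfl⟩ U
    · simp [diracAt, SubVal.dirac, haU]

theorem Kegelspitze.ext_of_conv {K : Type u} [PartialOrder K] {κ κ' : Kegelspitze K}
    (hconv : ∀ r a b, κ.conv r a b = κ'.conv r a b) (hbot : κ.bot = κ'.bot) : κ = κ' := by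
  obtain ⟨⟨⟨c, _, _, _, _⟩, b⟩, _, _, _⟩ := κ
  obtain ⟨⟨⟨c', _, _, _, _⟩, b'⟩, _, _, _⟩ := κ'
  obtain rfl : c = c' := funext fun r => funext fun a => funext fun b => hconv r a b
  obtain rfl : b = b' := hbot
  rfl

variable {a : SubVal (WithScott D) → D}

/-- The Kegelspitze structure defined by an algebra structure map. -/
noncomputable def Kegelspitze.ofAlgebra (ha : ScottContinuous a)
    (hunit : ∀ x, a (diracAt x) = x)
    (hlin : ∀ r μ ν, a (SubVal.conv r μ ν) =
      a (SubVal.conv r (diracAt (a μ)) (diracAt (a ν)))) : Kegelspitze D where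
  conv r x y := a (SubVal.conv r (diracAt x) (diracAt y))
  conv_one x y :=
    (congrArg a (SubVal.pointedBarycentricAlgebra.conv_one (diracAt x) (diracAt y))).trans (hunit x)
  conv_symm r x y :=
    congrArg a (SubVal.pointedBarycentricAlgebra.conv_symm r (diracAt x) (diracAt y))
  conv_self r x :=
    (congrArg a (SubVal.pointedBarycentricAlgebra.conv_self r (diracAt x))).trans (hunit x)
  conv_assoc p r q x y z hp hr hq := by
    -- Linearity removes the inner applications of `a`, and the law is inherited from valuations.
    have h1 := hlin r (SubVal.conv p (diracAt x) (diracAt y)) (diracAt z)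
    have h2 := hlin (p * r) (diracAt x) (SubVal.conv q (diracAt y) (diracAt z))
    rw [hunit] at h1 h2
    rw [← h1, ← h2]
    exact congrArg a (SubVal.pointedBarycentricAlgebra.conv_assoc p r q (diracAt x) (diracAt y)
      (diracAt z) hp hr hq)
  bot := a SubVal.zero
  isDcpo := D.isDcpo
  conv_scottContinuous r := by
    have h1 : ScottContinuous fun x : D × D => (diracAt x.1, diracAt x.2) :=
      ScottContinuous.prodMk (ScottContinuous.fst.comp scottContinuous_diracAt)
        (ScottContinuous.snd.comp scottContinuous_diracAt)
    exact (h1.comp (SubVal.kegelspitze.conv_scottContinuous r)).comp ha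
  smul_scottContinuous := by
    have h1 : ScottContinuous fun x : I × D => (x.1, diracAt x.2) :=
      ScottContinuous.prodMk ScottContinuous.fst (ScottContinuous.snd.comp scottContinuous_diracAt)
    -- The Dirac valuation at the bottom element can be exchanged for the zero valuation, so scalar
    -- multiplication factors through that of valuations.
    have h2 : (fun x : I × D => a (SubVal.conv x.1 (diracAt x.2) (diracAt (a SubVal.zero)))) =
        fun x => a (SubVal.conv x.1 (diracAt x.2) SubVal.zero) := by
      funext x
      rw [hlin x.1 (diracAt x.2) SubVal.zero, hunit]
    rw [h2]
    exact (h1.comp SubVal.kegelspitze.smul_scottContinuous).comp ha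

theorem isBaryLinear_ofAlgebra (ha : ScottContinuous a) (hunit : ∀ x, a (diracAt x) = x)
    (hlin : ∀ r μ ν, a (SubVal.conv r μ ν) =
      a (SubVal.conv r (diracAt (a μ)) (diracAt (a ν)))) :
    IsBaryLinear SubVal.pointedBarycentricAlgebra
      (Kegelspitze.ofAlgebra ha hunit hlin).toPointedBarycentricAlgebra a :=
  ⟨rfl, hlin⟩

theorem IsBaryLinear.comp {A : Type u} {B : Type v} {C : Type w} {α : PointedBarycentricAlgebra A}
    {β : PointedBarycentricAlgebra B} {γ : PointedBarycentricAlgebra C} {g : B → C} {f : A → B}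
    (hg : IsBaryLinear β γ g) (hf : IsBaryLinear α β f) : IsBaryLinear α γ fun x => g (f x) :=
  ⟨(congrArg g hf.1).trans hg.1, fun r a b => (congrArg g (hf.2 r a b)).trans (hg.2 r _ _)⟩

end AlgebraKegelspitze

/-! ### The monad of valuations -/

section Monad

variable {F : ValFamily.{u}}

/-- If the family contains all valuations on domains, then its members are the valuations. -/
def familyIso (hF : ∀ (D : Dom.{u}) (ν : SubVal (WithScott D)), ν ∈ F D) (D : Dom.{u}) :
    F D ≃o SubVal (WithScott D) where
  toFun := Subtype.val
  invFun ν := ⟨ν, hF D ν⟩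
  left_inv _ := rfl
  right_inv _ := rfl
  map_rel_iff' := Iff.rfl

theorem preservesDom_of_forall_mem
    (hF : ∀ (D : Dom.{u}) (ν : SubVal (WithScott D)), ν ∈ F D) : PreservesDom F where
  isDcpo D := SubVal.isDcpo.of_orderIso (familyIso hF D).symm
  isContinuous D := SubVal.isContinuousOrder.of_orderIso (familyIso hF D).symm

variable (hF : ∀ (D : Dom.{u}) (ν : SubVal (WithScott D)), ν ∈ F D)

/-- The domain of valuations. -/
abbrev valDom (D : Dom.{u}) : Dom.{u} := (preservesDom_of_forall_mem hF).obj D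

/-- The valuation underlying an element of the domain of valuations. -/
def toVal {D : Dom.{u}} (ν : valDom hF D) : SubVal (WithScott D) := familyIso hF D ν

/-- A valuation as an element of the domain of valuations. -/
def ofVal {D : Dom.{u}} (ν : SubVal (WithScott D)) : valDom hF D := (familyIso hF D).symm ν

variable {D E : Dom.{u}}

theorem scottContinuous_toVal : ScottContinuous (toVal hF (D := D)) :=
  (familyIso hF D).scottContinuous'

theorem scottContinuous_ofVal : ScottContinuous (ofVal hF (D := D)) :=
  (familyIso hF D).symm.scottContinuous'

theorem Dom.scottContinuous_app (f : D ⟶ E) : ScottContinuous (Dom.app f) :=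
  ScottMap.scottContinuous f

theorem Dom.hom_ext {f g : D ⟶ E} (h : ∀ x, Dom.app f x = Dom.app g x) : f = g :=
  ScottMap.ext (funext h)

theorem scottContinuous_toVal_app (f : D ⟶ valDom hF E) :
    ScottContinuous fun x => toVal hF (Dom.app f x) :=
  (Dom.scottContinuous_app f).comp (scottContinuous_toVal hF)

/-- The Kleisli extension on valuations. -/
noncomputable def kleisliExt (f : D ⟶ valDom hF E) : SubVal (WithScott D) → SubVal (WithScott E) :=
  extend SubVal.kegelspitze (scottContinuous_toVal_app hF f)

theorem scottContinuous_kleisliExt (f : D ⟶ valDom hF E) : ScottContinuous (kleisliExt hF f) :=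
  scottContinuous_extend _ _

theorem isBaryLinear_kleisliExt (f : D ⟶ valDom hF E) :
    IsBaryLinear SubVal.pointedBarycentricAlgebra SubVal.pointedBarycentricAlgebra
      (kleisliExt hF f) :=
  isBaryLinear_extend SubVal.kegelspitze _

theorem kleisliExt_diracAt (f : D ⟶ valDom hF E) (x : D) :
    kleisliExt hF f (diracAt x) = toVal hF (Dom.app f x) :=
  extend_dirac SubVal.kegelspitze _ x

/-- The unit of the monad of valuations. -/
noncomputable def valUnit (D : Dom.{u}) : D ⟶ valDom hF D :=
  (⟨fun x => ofVal hF (diracAt x), scottContinuous_diracAt.comp (scottContinuous_ofVal hF)⟩ :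
    ScottMap D (valDom hF D))

/-- The Kleisli extension of the monad of valuations. -/
noncomputable def valExt (f : D ⟶ valDom hF E) : valDom hF D ⟶ valDom hF E :=
  (⟨fun ν => ofVal hF (kleisliExt hF f (toVal hF ν)),
    ((scottContinuous_toVal hF).comp (scottContinuous_kleisliExt hF f)).comp
      (scottContinuous_ofVal hF)⟩ : ScottMap (valDom hF D) (valDom hF E))

/-- The monad of valuations. -/
noncomputable def valMonad : ValMonad F where
  preservesDom := preservesDom_of_forall_mem hF
  unit := valUnit hF
  val_unit _ _ := rfl
  ext := valExt hF
  val_ext f ν U := extend_apply (scottContinuous_toVal_app hF f) (toVal hF ν) U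
  -- In `ext_unit` and `ext_ext` both sides are Scott-continuous and linear in `ν`, so Dirac
  -- valuations decide.
  ext_unit D := Dom.hom_ext fun ν => congrArg (ofVal hF)
    (eq_of_forall_dirac (β := SubVal.pointedBarycentricAlgebra) (h := fun ν => ν)
      (scottContinuous_kleisliExt hF _) (isBaryLinear_kleisliExt hF _)
      ScottContinuous.id ⟨rfl, fun _ _ _ => rfl⟩ (kleisliExt_diracAt hF _) (toVal hF ν))
  unit_ext f := Dom.hom_ext fun x => congrArg (ofVal hF) (kleisliExt_diracAt hF f x)
  ext_ext f g := Dom.hom_ext fun ν => congrArg (ofVal hF)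
    (eq_of_forall_dirac (β := SubVal.pointedBarycentricAlgebra)
      (g := fun ν => kleisliExt hF g (kleisliExt hF f ν))
      ((scottContinuous_kleisliExt hF f).comp (scottContinuous_kleisliExt hF g))
      ((isBaryLinear_kleisliExt hF g).comp (isBaryLinear_kleisliExt hF f))
      (scottContinuous_kleisliExt hF _) (isBaryLinear_kleisliExt hF _)
      (fun x => by rw [kleisliExt_diracAt, kleisliExt_diracAt]; rfl) (toVal hF ν))

/-- The action of the functor of valuations on a map. -/
noncomputable def pushforward (f : D ⟶ E) : SubVal (WithScott D) → SubVal (WithScott E) :=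
  kleisliExt hF (f ≫ valUnit hF E)

theorem pushforward_diracAt (f : D ⟶ E) (x : D) :
    pushforward hF f (diracAt x) = diracAt (Dom.app f x) :=
  kleisliExt_diracAt hF _ x

theorem pushforward_conv (f : D ⟶ E) (r : I) (μ ν : SubVal (WithScott D)) :
    pushforward hF f (SubVal.conv r μ ν) =
      SubVal.conv r (pushforward hF f μ) (pushforward hF f ν) :=
  (isBaryLinear_kleisliExt hF _).2 r μ ν

theorem pushforward_zero (f : D ⟶ E) : pushforward hF f SubVal.zero = SubVal.zero :=
  (isBaryLinear_kleisliExt hF _).1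

/-- The structure morphism of an algebra. -/
def structureHom (𝒜 : (valMonad hF).monad.Algebra) : valDom hF 𝒜.A ⟶ 𝒜.A := 𝒜.a

/-- The structure map of an algebra, as a map on valuations. -/
noncomputable def structureMap (𝒜 : (valMonad hF).monad.Algebra) (ν : SubVal (WithScott 𝒜.A)) :
    𝒜.A :=
  Dom.app (structureHom hF 𝒜) (ofVal hF ν)

theorem scottContinuous_structureMap (𝒜 : (valMonad hF).monad.Algebra) :
    ScottContinuous (structureMap hF 𝒜) :=
  (scottContinuous_ofVal hF).comp (Dom.scottContinuous_app (structureHom hF 𝒜))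

theorem structureMap_diracAt (𝒜 : (valMonad hF).monad.Algebra) (x : 𝒜.A) :
    structureMap hF 𝒜 (diracAt x) = x :=
  congrArg (fun f : 𝒜.A ⟶ 𝒜.A => Dom.app f x) 𝒜.unit

theorem structureMap_mul (𝒜 : (valMonad hF).monad.Algebra)
    (M : SubVal (WithScott (valDom hF 𝒜.A))) :
    structureMap hF 𝒜 (kleisliExt hF (𝟙 (valDom hF 𝒜.A)) M) =
      structureMap hF 𝒜 (pushforward hF (structureHom hF 𝒜) M) :=
  congrArg (fun f : valDom hF (valDom hF 𝒜.A) ⟶ 𝒜.A => Dom.app f (ofVal hF M)) 𝒜.assoc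

/-- This is the associativity law of the algebra at `δ_μ +_r δ_ν`: the multiplication sends it to `μ
+_r ν`, and the pushforward of the structure map replaces `μ` and `ν` by their values. -/
theorem structureMap_conv (𝒜 : (valMonad hF).monad.Algebra) (r : I)
    (μ ν : SubVal (WithScott 𝒜.A)) :
    structureMap hF 𝒜 (SubVal.conv r μ ν) =
      structureMap hF 𝒜 (SubVal.conv r (diracAt (structureMap hF 𝒜 μ))
        (diracAt (structureMap hF 𝒜 ν))) := by
  have h := structureMap_mul hF 𝒜 (SubVal.conv r (diracAt (ofVal hF μ)) (diracAt (ofVal hF ν)))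
  rw [pushforward_conv, pushforward_diracAt, pushforward_diracAt] at h
  refine Eq.trans (congrArg _ ?_) h
  refine Eq.trans ?_ ((isBaryLinear_kleisliExt hF _).2 r _ _).symm
  rw [kleisliExt_diracAt, kleisliExt_diracAt]
  rfl

/-- The Kegelspitze structure of an algebra. -/
noncomputable def algebraKegelspitze (𝒜 : (valMonad hF).monad.Algebra) : Kegelspitze 𝒜.A :=
  Kegelspitze.ofAlgebra (scottContinuous_structureMap hF 𝒜) (structureMap_diracAt hF 𝒜)
    (structureMap_conv hF 𝒜)

theorem structureMap_naturality {𝒜 ℬ : (valMonad hF).monad.Algebra} (f : 𝒜 ⟶ ℬ)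
    (ν : SubVal (WithScott 𝒜.A)) :
    structureMap hF ℬ (pushforward hF f.f ν) = Dom.app f.f (structureMap hF 𝒜 ν) :=
  congrArg (fun f : valDom hF 𝒜.A ⟶ ℬ.A => Dom.app f (ofVal hF ν)) f.h

/-- The functor from algebras to continuous Kegelspitzen. -/
noncomputable def algebraToKegelspitze : (valMonad hF).monad.Algebra ⥤ ContKegelspitze.{u} where
  obj 𝒜 := ⟨𝒜.A, algebraKegelspitze hF 𝒜⟩
  map {𝒜 ℬ} f := ⟨f.f, by
    constructor
    -- Linearity of an algebra map is its naturality at the zero valuation and at two-point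
    -- valuations.
    · have h := structureMap_naturality hF f SubVal.zero
      rw [pushforward_zero] at h
      exact h.symm
    · intro r x y
      have h := structureMap_naturality hF f (SubVal.conv r (diracAt x) (diracAt y))
      rw [pushforward_conv, pushforward_diracAt, pushforward_diracAt] at h
      exact h.symm⟩

/-- The barycenter map of a continuous Kegelspitze. -/
noncomputable def barycenter (K : ContKegelspitze.{u}) : SubVal (WithScott K.dom) → K.dom :=
  extend (D := K.dom) K.kegelspitze (f := fun x => x) ScottContinuous.id

theorem scottContinuous_barycenter (K : ContKegelspitze.{u}) : ScottContinuous (barycenter K) :=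
  scottContinuous_extend _ _

theorem isBaryLinear_barycenter (K : ContKegelspitze.{u}) :
    IsBaryLinear SubVal.pointedBarycentricAlgebra K.kegelspitze.toPointedBarycentricAlgebra
      (barycenter K) :=
  isBaryLinear_extend _ _

theorem barycenter_diracAt (K : ContKegelspitze.{u}) (x : K.dom) :
    barycenter K (diracAt x) = x :=
  extend_dirac _ _ x

theorem barycenter_naturality {K L : ContKegelspitze.{u}} (f : K ⟶ L)
    (ν : SubVal (WithScott K.dom)) :
    barycenter L (pushforward hF f.map ν) = Dom.app f.map (barycenter K ν) :=
  eq_of_forall_dirac (β := L.kegelspitze.toPointedBarycentricAlgebra)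
    (g := fun ν => barycenter L (pushforward hF f.map ν))
    (h := fun ν => Dom.app f.map (barycenter K ν))
    ((scottContinuous_kleisliExt hF _).comp (scottContinuous_barycenter L))
    ((isBaryLinear_barycenter L).comp (isBaryLinear_kleisliExt hF _))
    ((scottContinuous_barycenter K).comp (Dom.scottContinuous_app f.map))
    (f.linear.comp (isBaryLinear_barycenter K))
    (fun x => by
      change barycenter L (pushforward hF f.map (diracAt x)) =
        Dom.app f.map (barycenter K (diracAt x))
      rw [pushforward_diracAt, barycenter_diracAt, barycenter_diracAt]) ν

/-- The barycenter map, as a morphism of domains. -/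
noncomputable def barycenterHom (K : ContKegelspitze.{u}) : valDom hF K.dom ⟶ K.dom :=
  (⟨fun ν => barycenter K (toVal hF ν),
    (scottContinuous_toVal hF).comp (scottContinuous_barycenter K)⟩ :
    ScottMap (valDom hF K.dom) K.dom)

/-- The algebra of a continuous Kegelspitze. -/
noncomputable def kegelspitzeAlgebra (K : ContKegelspitze.{u}) : (valMonad hF).monad.Algebra where
  A := K.dom
  a := barycenterHom hF K
  unit := Dom.hom_ext fun x => barycenter_diracAt K x
  assoc := Dom.hom_ext (D := valDom hF (valDom hF K.dom)) fun M =>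
    eq_of_forall_dirac (D := valDom hF K.dom)
      (β := K.kegelspitze.toPointedBarycentricAlgebra)
      (g := fun M => barycenter K (kleisliExt hF (𝟙 (valDom hF K.dom)) M))
      (h := fun M => barycenter K (pushforward hF (barycenterHom hF K) M))
      ((scottContinuous_kleisliExt hF _).comp (scottContinuous_barycenter K))
      ((isBaryLinear_barycenter K).comp (isBaryLinear_kleisliExt hF _))
      ((scottContinuous_kleisliExt hF _).comp (scottContinuous_barycenter K))
      ((isBaryLinear_barycenter K).comp (isBaryLinear_kleisliExt hF _))
      (fun ν => by
        change barycenter K (kleisliExt hF (𝟙 (valDom hF K.dom)) (diracAt ν)) =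
          barycenter K (pushforward hF (barycenterHom hF K) (diracAt ν))
        rw [pushforward_diracAt, barycenter_diracAt, kleisliExt_diracAt]
        rfl) (toVal hF M)

/-- The functor from continuous Kegelspitzen to algebras. -/
noncomputable def kegelspitzeToAlgebra : ContKegelspitze.{u} ⥤ (valMonad hF).monad.Algebra where
  obj K := kegelspitzeAlgebra hF K
  map {K L} f :=
    { f := f.map
      h := Dom.hom_ext (D := valDom hF K.dom) fun ν =>
        barycenter_naturality hF f (toVal hF ν) }

/-- The barycenter map and the original structure map are both Scott-continuous, linear for the
derived operations, and send `δ_x` to `x`. -/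
theorem kegelspitzeAlgebra_algebraKegelspitze (𝒜 : (valMonad hF).monad.Algebra) :
    kegelspitzeAlgebra hF ⟨𝒜.A, algebraKegelspitze hF 𝒜⟩ = 𝒜 := by
  have h : barycenterHom hF ⟨𝒜.A, algebraKegelspitze hF 𝒜⟩ = 𝒜.a :=
    Dom.hom_ext (D := valDom hF 𝒜.A) fun ν =>
      eq_of_forall_dirac (β := (algebraKegelspitze hF 𝒜).toPointedBarycentricAlgebra)
        (g := barycenter ⟨𝒜.A, algebraKegelspitze hF 𝒜⟩) (scottContinuous_barycenter _)
        (isBaryLinear_barycenter _)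
        (scottContinuous_structureMap hF 𝒜) (isBaryLinear_ofAlgebra _ _ _)
        (fun x => (barycenter_diracAt _ x).trans (structureMap_diracAt hF 𝒜 x).symm) (toVal hF ν)
  unfold kegelspitzeAlgebra
  cases 𝒜
  simp only at h
  congr

/-- Linearity of the barycenter map at Dirac valuations recovers the original operations. -/
theorem algebraKegelspitze_kegelspitzeAlgebra (K : ContKegelspitze.{u}) :
    (⟨K.dom, algebraKegelspitze hF (kegelspitzeAlgebra hF K)⟩ : ContKegelspitze.{u}) = K := by
  have h : algebraKegelspitze hF (kegelspitzeAlgebra hF K) = K.kegelspitze := by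
    refine Kegelspitze.ext_of_conv (fun r (x y : K.dom) => ?_) (isBaryLinear_barycenter K).1
    exact ((isBaryLinear_barycenter K).2 r (diracAt x) (diracAt y)).trans
      (congrArg₂ (K.kegelspitze.conv r) (barycenter_diracAt K x) (barycenter_diracAt K y))
  cases K
  exact congrArg (ContKegelspitze.mk _) h

instance : ContKegelspitze.forget.{u}.Faithful where
  map_injective h := ContKegelspitze.Hom.ext h

/-- An endofunctor is the identity if it fixes the objects and its action on maps is the identity
under a faithful functor. -/
theorem eq_id_of_faithful {C : Type*} [Category C] {B : Type*} [Category B] (U : C ⥤ B)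
    [U.Faithful] (G : C ⥤ C) (hobj : ∀ X, G.obj X = X)
    (hmap : ∀ {X Y : C} (f : X ⟶ Y), U.map (G.map f) = eqToHom (congrArg U.obj (hobj X)) ≫
      U.map f ≫ eqToHom (congrArg U.obj (hobj Y)).symm) : G = 𝟭 C :=
  CategoryTheory.Functor.ext hobj fun X Y f =>
    U.map_injective (by simp [hmap, eqToHom_map])

/-- Both functors keep underlying domains and maps unchanged, so after forgetting, the condition on
maps holds by definition. -/
theorem algebraToKegelspitze_comp :
    algebraToKegelspitze hF ⋙ kegelspitzeToAlgebra hF = 𝟭 _ :=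
  eq_id_of_faithful (valMonad hF).monad.forget _ (kegelspitzeAlgebra_algebraKegelspitze hF)
    fun _ => rfl

theorem kegelspitzeToAlgebra_comp :
    kegelspitzeToAlgebra hF ⋙ algebraToKegelspitze hF = 𝟭 _ :=
  eq_id_of_faithful ContKegelspitze.forget _ (algebraKegelspitze_kegelspitzeAlgebra hF)
    fun _ => rfl

end Monad

theorem mainTheorem5 :
    (∀ D : Dom.{u}, familyM D = familyV D ∧ familyW D = familyV D ∧ familyP D = familyV D) ∧
    (∀ F : ValFamily.{u}, F = familyM ∨ F = familyV ∨ F = familyW ∨ F = familyP →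
      ∃ (T : ValMonad F) (Φ : T.monad.Algebra ⥤ ContKegelspitze.{u})
        (Ψ : ContKegelspitze.{u} ⥤ T.monad.Algebra),
        Φ ⋙ Ψ = 𝟭 _ ∧ Ψ ⋙ Φ = 𝟭 _ ∧
        Φ ⋙ ContKegelspitze.forget = T.monad.forget) := by
  refine ⟨fun D => ⟨familyM_eq D, familyW_eq D, familyP_eq D⟩, fun F h => ?_⟩
  -- Only agreement with all valuations on domains matters, so one construction serves all four
  -- families.
  have hF : ∀ (D : Dom.{u}) (ν : SubVal (WithScott D)), ν ∈ F D := by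
    intro D ν
    have hD : F D = familyV D := by
      rcases h with rfl | rfl | rfl | rfl
      exacts [familyM_eq D, rfl, familyW_eq D, familyP_eq D]
    rw [hD]
    exact Set.mem_univ ν
  exact ⟨valMonad hF, algebraToKegelspitze hF, kegelspitzeToAlgebra hF,
    algebraToKegelspitze_comp hF, kegelspitzeToAlgebra_comp hF, rfl⟩
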